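/- Let $G=(V,E)$ be a countable simple graph whose vertex degrees are bounded by some $\Delta<\infty$, let $0\le\alpha<1$, and let $E_v$ denote the set of edges incident to $v\in V$. Let $(P_v)_{v\in V}$ be independent Poisson point processes on $[0,\infty)\times[0,1]$ whose intensity is Lebesgue measure, on a probability space $(\Omega,\mathbb P)$. Consider the weights $N_t=(N_t(e))_{e\in E}$, $t\ge 0$, that start from $N_0\equiv 1$ and evolve as follows: whenever $P_v$ has an atom $(t,u)$, the weight of $e_i\in E_v=\{e_1,\dots,e_{\deg v}\}$ (a fixed enumeration) is increased by $1$ if $$\sum_{j\le i-1}\mathrm{pol}_{v,e_j}(N_{t-})<u\le\sum_{j\le i}\mathrm{pol}_{v,e_j}(N_{t-}),\qquad \mathrm{pol}_{v,e}(w)=\frac{w(e)^\alpha}{\sum_{e'\in E_v}w(e')^\alpha},$$ where $N_t$ is determined, up to null sets, by the atoms with time coordinate at most $t$. Put $X_t(e)=N_t(e)/t$ and $X_-(e)=\liminf_{t\to\infty}X_t(e)$. For $e\in E$ let $E_e=\{e'\in E: e'\cap e\neq\emptyset\}$ (so $e\in E_e$), and let $\mathcal F_{e^c}$ be the $\sigma$-algebra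 generated by the processes $P_v$ with $v\notin\bigcup_{e'\in E_e}e'$. 1. (Rate lower bound.) Let $\mu\in(0,\infty)^E$ be a non-vanishing equilibrium, that is, $\mu(e)=\sum_{v\in e}\mu(e)^\alpha/\sum_{e'\in E_v}\mu(e')^\alpha$ for all $e\in E$. Call an edge $e$ $\delta$-unstable if $\min_{e'\in E_e}X_-(e')/\mu(e')<\delta$. Then there exists $\delta_0>0$ such that, with probability $1$, all connected components of $\delta_0$-unstable edges are finite, where two edges are neighbours if they share a vertex. 2. (Compact containment.) For every $\varepsilon>0$ there exists $\delta>0$ such that, almost surely, $\mathbb P(X_-(e)\ge\delta\mid\mathcal F_{e^c})\ge 1-\varepsilon$ for all $e\in E$. In particular, for every $e\in E$, $\mathbb P(X_-(e)>0\mid\mathcal F_{e^c})=1$ almost surely. -/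

import Mathlib

open MeasureTheory ProbabilityTheory Filter
open scoped NNReal ENNReal unitInterval

noncomputable section

namespace PolyaNetwork

/-! ### Poisson clocks -/

/-- The space of atoms `(t, u)`: a clock-ring time `t ∈ [0, ∞)` together with a mark
`u ∈ [0, 1]`. -/
abbrev Atom : Type := ℝ≥0 × I

/-- Lebesgue measure on `[0, ∞) × [0, 1]`. -/
def atomVolume : Measure Atom :=
  (Measure.comap ((↑) : ℝ≥0 → ℝ) (volume : Measure ℝ)).prod (volume : Measure I)

/-- A random set of points `Z` is a Poisson point process with intensity measure `ν`: the number
of points in a measurable set `B` is a random variable, it is Poisson distributed with parameter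
`ν B` when this is finite, and the numbers of points in pairwise disjoint measurable sets are
independent. -/
structure IsPoissonProcess {Ω S : Type*} [MeasurableSpace Ω] [MeasurableSpace S]
    (P : Measure Ω) (ν : Measure S) (Z : Ω → Set S) : Prop where
  measurable_count : ∀ B : Set S, MeasurableSet B → Measurable fun ω => (Z ω ∩ B).encard
  law_count : ∀ B : Set S, MeasurableSet B → ν B ≠ ∞ →
    P.map (fun ω => (Z ω ∩ B).encard) =
      (poissonMeasure (ν B).toNNReal).map (Nat.cast : ℕ → ℕ∞)
  indep_count : ∀ (n : ℕ) (B : Fin n → Set S), (∀ i, MeasurableSet (B i)) →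
    Pairwise (fun i j => Disjoint (B i) (B j)) →
    iIndepFun (fun i ω => (Z ω ∩ B i).encard) P

/-- The σ-algebra on `Ω` generated by the numbers of points of `Z` in the measurable subsets
of `R`. -/
abbrev pointSigma {Ω S : Type*} [MeasurableSpace S] (Z : Ω → Set S) (R : Set S) :
    MeasurableSpace Ω :=
  ⨆ B : {B : Set S // MeasurableSet B ∧ B ⊆ R},
    MeasurableSpace.comap (fun ω => (Z ω ∩ B.1).encard) inferInstance

/-- An i.i.d. family, indexed by the vertices, of Poisson processes on `[0, ∞) × [0, 1]` whose
intensity measure is Lebesgue measure. -/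
structure IsClockFamily {V Ω : Type*} [MeasurableSpace Ω] (P : Measure Ω)
    (clock : V → Ω → Set Atom) : Prop where
  poisson : ∀ v, IsPoissonProcess P atomVolume (clock v)
  indep : iIndep (fun v => pointSigma (clock v) Set.univ) P

/-- The σ-algebra generated by the atoms of all clocks up to time `t`. -/
abbrev clockHistory {V Ω : Type*} (clock : V → Ω → Set Atom) (t : ℝ≥0) : MeasurableSpace Ω :=
  ⨆ v, pointSigma (clock v) {p | p.1 ≤ t}

/-! ### The Pólya rule and the reinforced dynamics -/

variable {V : Type*} (G : SimpleGraph V)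

/-- The edge joining `v` to its neighbour `z`. As `z` runs through the neighbours of `v`, this
runs bijectively through the set `E_v` of edges incident to `v`. -/
def edgeTo (v : V) (z : G.neighborSet v) : G.edgeSet := ⟨s(v, z.1), z.2⟩

/-- The probability `w(e)^α / ∑_{e' ∈ E_v} w(e')^α` that `v` selects its incident edge `e`. -/
def pol [G.LocallyFinite] (α : ℝ) (w : G.edgeSet → ℝ) (v : V) (e : G.edgeSet) : ℝ :=
  w e ^ α / ∑ z : G.neighborSet v, w (edgeTo G v z) ^ α

/-- The non-negative vector `μ` is an equilibrium on `G`: each edge `e = {x, y}` with `μ e > 0`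
satisfies `μ e = pol_{x,e}(μ) + pol_{y,e}(μ)`. -/
def IsEquilibrium [G.LocallyFinite] (α : ℝ) (μ : G.edgeSet → ℝ≥0) : Prop :=
  ∀ (x y : V) (h : G.Adj x y), 0 < μ ⟨s(x, y), h⟩ →
    (μ ⟨s(x, y), h⟩ : ℝ) =
      pol G α (fun e => (μ e : ℝ)) x ⟨s(x, y), h⟩ + pol G α (fun e => (μ e : ℝ)) y ⟨s(x, y), h⟩

/-- Given the enumeration `ord v` of the edges incident to `v` (through the neighbours of `v`),
the interval of marks for which a ring of the clock of `v` selects the `i`-th incident edge. -/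
def markInterval [G.LocallyFinite] (α : ℝ) (ord : ∀ v, Fin (G.degree v) ≃ G.neighborSet v)
    (w : G.edgeSet → ℝ) (v : V) (i : Fin (G.degree v)) : Set ℝ :=
  Set.Ioc (∑ j ∈ Finset.Iio i, pol G α w v (edgeTo G v (ord v j)))
    (∑ j ∈ Finset.Iic i, pol G α w v (edgeTo G v (ord v j)))

/-- For a deterministic configuration `Z` of atoms and a trajectory `n` of weights, the clock
rings up to time `t` that select the edge `e`, each recorded with the vertex that rings. The
selection at time `s` uses the weights right before time `s`. -/
def reinforcements [G.LocallyFinite] (α : ℝ) (ord : ∀ v, Fin (G.degree v) ≃ G.neighborSet v)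
    (Z : V → Set Atom) (n : ℝ≥0 → G.edgeSet → ℕ) (t : ℝ≥0) (e : G.edgeSet) :
    Set (V × Atom) :=
  {q | q.2 ∈ Z q.1 ∧ q.2.1 ≤ t ∧
    ∃ i : Fin (G.degree q.1), edgeTo G q.1 (ord q.1 i) = e ∧
      (q.2.2 : ℝ) ∈ markInterval G α ord
        (fun e' => ((Function.leftLim (fun r => n r e') q.2.1 : ℕ) : ℝ)) q.1 i}

/-- `N` is the system of weakly reinforced Pólya urns on the edges of `G` driven by the i.i.d.
Poisson clocks `clock`: all weights start at `1`, the weight of an edge is increased by `1` each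
time one of its endpoints rings and selects it, and the weights at time `t` are determined by the
clocks up to time `t` (up to null sets). -/
structure IsUrnNetwork [G.LocallyFinite] {Ω : Type*} [MeasurableSpace Ω] (P : Measure Ω) (α : ℝ)
    (ord : ∀ v, Fin (G.degree v) ≃ G.neighborSet v) (clock : V → Ω → Set Atom)
    (N : ℝ≥0 → Ω → G.edgeSet → ℕ) : Prop where
  clocks : IsClockFamily P clock
  adapted : ∀ t e, AEStronglyMeasurable[clockHistory clock t] (fun ω => N t ω e) P
  dynamics : ∀ᵐ ω ∂P, ∀ t e,
    (N t ω e : ℕ∞) =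
      1 + (reinforcements G α ord (fun v => clock v ω) (fun r => N r ω) t e).encard

/-! ### Rates, stable edges, and the far σ-algebra -/

variable {G}

/-- `X_t(e) = N_t(e) / t`. -/
def rate {Ω : Type*} (N : ℝ≥0 → Ω → G.edgeSet → ℕ) (t : ℝ≥0) (ω : Ω) (e : G.edgeSet) : ℝ≥0∞ :=
  (N t ω e : ℝ≥0∞) / t

/-- `X_-(e) = liminf_{t → ∞} X_t(e)`. -/
def lowerRate {Ω : Type*} (N : ℝ≥0 → Ω → G.edgeSet → ℕ) (ω : Ω) (e : G.edgeSet) : ℝ≥0∞ :=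
  liminf (fun t : ℝ≥0 => rate N t ω e) atTop

/-- `E_e`: the edges `e'` with `e' ∩ e ≠ ∅`, including `e` itself. -/
def adjacentEdges (e : G.edgeSet) : Set G.edgeSet :=
  {e' | ∃ v : V, v ∈ e'.1 ∧ v ∈ e.1}

/-- The edge `e` is `δ`-stable: `X_-(e') / μ(e') ≥ δ` for all `e' ∈ E_e`. -/
def IsStable {Ω : Type*} (N : ℝ≥0 → Ω → G.edgeSet → ℕ) (μ : G.edgeSet → ℝ≥0) (δ : ℝ≥0) (ω : Ω)
    (e : G.edgeSet) : Prop :=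
  ∀ e' ∈ adjacentEdges e, (δ : ℝ≥0∞) ≤ lowerRate N ω e' / (μ e' : ℝ≥0∞)

/-- The graph on the `δ`-unstable edges in which two edges are joined if they share a vertex. -/
def unstableGraph {Ω : Type*} (N : ℝ≥0 → Ω → G.edgeSet → ℕ) (μ : G.edgeSet → ℝ≥0) (δ : ℝ≥0)
    (ω : Ω) : SimpleGraph {e : G.edgeSet | ¬ IsStable N μ δ ω e} :=
  G.lineGraph.induce {e : G.edgeSet | ¬ IsStable N μ δ ω e}

/-- `F_{e^c}`: the σ-algebra generated by the clocks at all vertices that belong to no edge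
of `E_e`. -/
abbrev farSigma {Ω : Type*} (clock : V → Ω → Set Atom) (e : G.edgeSet) : MeasurableSpace Ω :=
  ⨆ v : {v : V // ∀ e' ∈ adjacentEdges e, v ∉ e'.1}, pointSigma (clock v.1) Set.univ

end PolyaNetwork

end

/-!
Fix an edge `e` with an endpoint `x`. As long as the clocks in the closed neighbourhood of `x`
ring at most linearly often (`Crowded` is the event that they do not, and Poisson tails make it
unlikely), every weight at `x` is of order at most `t` at time `t`. If moreover the weight of `e` is
at least `2 ^ (-k₀) t`, then each ring of `x` selects `e` with probability at least
`p = c 2 ^ (-k₀ α)`. During the time window `[2 ^ k, 2 ^ (k + 1)]` the weight of `e` thus grows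
by about `p 2 ^ k`, and since `α < 1` this is much more than the increase by `2 ^ (k - k₀)` that
is needed to keep the weight above `2 ^ (-k₀) t`. Since the bound holds for free at time `2 ^ k₀`,
where the weight is at least `1`, the lower rate of `e` is at least `2 ^ (-(k₀ + 1))` unless a
clock is crowded or one of the windows is slow (`le_lowerRate`), and the sum of the probabilities of
these events tends to `0` as `k₀ → ∞` (`exists_lowRateBound_le`).

Which marks of the clock of `x` select `e` depends on all the weights at `x`, hence on clocks far
away, so that slow windows are not local events. They are handled by an exponential moment on a fine
grid of times: with the weights frozen at the beginning of a cell, the marks in the cell are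
independent of the past of all clocks and of the whole of the other clocks
(`IsClockFamily.indep_restSigma`), so that each cell contributes a factor of at most
`1 - 2 ^ (-j) p / 4` to the expectation of the product of the cell factors, jointly for several
vertices and conditionally on the remaining clocks (`lintegral_mul_cellFactor_le`,
`lintegral_prod_windowFactor_le`). On a sufficiently fine grid the frozen selections are true
selections (`IsTrajectory.eventually_card_add_le`), and Fatou's lemma gives a product bound for
the probability of simultaneous slow windows (`IsUrnNetwork.measure_slowWindow_le`). Together with
the independence of the crowded events this shows that edges with well-separated endpoints
simultaneously have low rates with probability at most `ε ^ n`, also given the clocks far away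
(`IsUrnNetwork.measure_lowerRate_lt_le`).

For a single edge this is the conditional bound on the lower rate. For the unstable edges,
equilibrium weights are at most `2`, so each unstable edge has low rate or shares a vertex
with an edge of low rate. An infinite
component would contain arbitrarily long chains of edges of low rate, pairwise separated and with
bounded steps (`exists_separated_chain`, `exists_chain_of_infinite`); there are at most exponentially
many of these, and each has probability at most `ε ^ n`.
-/

namespace PolyaNetwork

/-! ### Poisson processes -/

section Poisson

variable {Ω S : Type*} [MeasurableSpace Ω] [MeasurableSpace S]
  {P : Measure Ω} {ν : Measure S} {Z : Ω → Set S}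

lemma IsPoissonProcess.pointSigma_le (h : IsPoissonProcess P ν Z) (R : Set S) :
    pointSigma Z R ≤ ‹MeasurableSpace Ω› :=
  iSup_le fun B => (h.measurable_count B.1 B.2.1).comap_le

omit [MeasurableSpace Ω] in
lemma comap_count_le_pointSigma {B R : Set S} (hB : MeasurableSet B) (hBR : B ⊆ R) :
    MeasurableSpace.comap (fun ω => (Z ω ∩ B).encard) inferInstance ≤ pointSigma Z R :=
  le_iSup (fun B : {B : Set S // MeasurableSet B ∧ B ⊆ R} =>
    MeasurableSpace.comap (fun ω => (Z ω ∩ B.1).encard) inferInstance) ⟨B, hB, hBR⟩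

omit [MeasurableSpace Ω] in
lemma pointSigma_mono {R R' : Set S} (h : R ⊆ R') : pointSigma Z R ≤ pointSigma Z R' :=
  iSup_le fun B => comap_count_le_pointSigma B.2.1 (B.2.2.trans h)

omit [MeasurableSpace Ω] in
lemma measurable_count_pointSigma {B R : Set S} (hB : MeasurableSet B) (hBR : B ⊆ R) :
    Measurable[pointSigma Z R] fun ω => (Z ω ∩ B).encard :=
  measurable_iff_comap_le.2 (comap_count_le_pointSigma hB hBR)

/-- The independence of the counts of pairwise disjoint sets, for an arbitrary finite index
type. -/
lemma IsPoissonProcess.indep_count_fintype (h : IsPoissonProcess P ν Z) {ι : Type*} [Finite ι]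
    (B : ι → Set S) (hB : ∀ i, MeasurableSet (B i))
    (hd : Pairwise fun i j => Disjoint (B i) (B j)) :
    iIndepFun (fun i ω => (Z ω ∩ B i).encard) P := by
  obtain ⟨n, ⟨f⟩⟩ := Finite.exists_equiv_fin ι
  have := h.indep_count n (fun i => B (f.symm i)) (fun i => hB _)
    (fun i j hij => hd (f.symm.injective.ne hij))
  have h2 := this.precomp f.injective
  simpa using h2

/-- The points of a Poisson process in `B` are independent of those in a disjoint set `R`. -/
lemma IsPoissonProcess.indep_count_pointSigma [IsProbabilityMeasure P]
    (h : IsPoissonProcess P ν Z) {B R : Set S} (hB : MeasurableSet B)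
    (hBR : Disjoint B R) :
    Indep (MeasurableSpace.comap (fun ω => (Z ω ∩ B).encard) inferInstance)
      (pointSigma Z R) P := by
  classical
  -- `pointSigma Z R` is the directed supremum, over finite families of subsets of `R`, of the
  -- σ-algebras generated by the counts of the members of the family.
  have key : pointSigma Z R = ⨆ F : Finset {B : Set S // MeasurableSet B ∧ B ⊆ R},
      ⨆ b ∈ F, MeasurableSpace.comap (fun ω => (Z ω ∩ b.1).encard) inferInstance :=
    iSup_eq_iSup_finset _
  rw [key]
  refine (indep_iSup_of_directed_le (fun F => ?_) (fun F => ?_) ?_ ?_).symm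
  · -- the nonempty cells of the partition generated by the family
    let D : Option (Set F) → Set S := fun o => o.elim B
      fun T => if T.Nonempty then {z | ∀ b : F, z ∈ b.1.1 ↔ b ∈ T} else ∅
    have hDm : ∀ o, MeasurableSet (D o) := by
      rintro (_ | T)
      · exact hB
      · change MeasurableSet (if T.Nonempty then {z | ∀ b : F, z ∈ b.1.1 ↔ b ∈ T} else ∅)
        split_ifs
        · rw [Set.ofPred_forall]
          refine MeasurableSet.iInter fun b => ?_
          by_cases hb : b ∈ T
          · simpa [hb] using b.1.2.1
          · have : {z | z ∈ b.1.1 ↔ b ∈ T} = b.1.1ᶜ := by ext z; simp [hb]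
            rw [this]
            exact b.1.2.1.compl
        · exact MeasurableSet.empty
    have hDR : ∀ T, D (some T) ⊆ R := by
      intro T z hz
      change z ∈ (if T.Nonempty then {z | ∀ b : F, z ∈ b.1.1 ↔ b ∈ T} else ∅) at hz
      split_ifs at hz with hT
      · obtain ⟨b, hb⟩ := hT
        exact b.1.2.2 ((hz b).2 hb)
      · exact hz.elim
    have hDd : Pairwise fun i j => Disjoint (D i) (D j) := by
      rintro (_ | T) (_ | T') hne
      · exact (hne rfl).elim
      · exact hBR.mono_right (hDR T')
      · exact (hBR.mono_right (hDR T)).symm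
      · refine Set.disjoint_left.2 fun z hz hz' => hne ?_
        change z ∈ (if T.Nonempty then {z | ∀ b : F, z ∈ b.1.1 ↔ b ∈ T} else ∅) at hz
        change z ∈ (if T'.Nonempty then {z | ∀ b : F, z ∈ b.1.1 ↔ b ∈ T'} else ∅) at hz'
        split_ifs at hz hz'
        · congr 1
          ext b
          rw [← hz b, hz' b]
        all_goals simp_all
    have hind := h.indep_count_fintype D hDm hDd
    have hpair := hind.indepFun_finset (Finset.univ.erase none) {none}
      (by simp) (fun o => h.measurable_count _ (hDm o))
    refine indep_of_indep_of_le_right (indep_of_indep_of_le_left hpair ?_) ?_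
    · refine iSup₂_le fun b hb => ?_
      have hsum : (fun ω => (Z ω ∩ b.1).encard) =
          (fun c : (Finset.univ.erase (none : Option (Set F))) → ℕ∞ =>
            ∑ T : Set F, if ⟨b, hb⟩ ∈ T then c ⟨some T, by simp⟩ else 0) ∘
          fun ω (i : (Finset.univ.erase (none : Option (Set F)))) => (Z ω ∩ D i).encard := by
        funext ω
        have : Z ω ∩ b.1 = ⋃ T : {T : Set F // ⟨b, hb⟩ ∈ T}, (Z ω ∩ D (some T.1)) := by
          ext z
          simp only [Set.mem_inter_iff, Set.mem_iUnion]
          constructor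
          · rintro ⟨h1, h2⟩
            refine ⟨⟨{c | z ∈ c.1.1}, h2⟩, h1, ?_⟩
            change z ∈ (if _ then _ else _)
            rw [if_pos ⟨⟨b, hb⟩, h2⟩]
            intro c
            rfl
          · rintro ⟨⟨T, hT⟩, h1, h2⟩
            refine ⟨h1, ?_⟩
            change z ∈ (if _ then _ else _) at h2
            rw [if_pos ⟨_, hT⟩] at h2
            exact (h2 ⟨b, hb⟩).2 hT
        rw [this, Set.encard_iUnion_of_finite, finsum_eq_sum_of_fintype]
        · simp only [Function.comp]
          rw [← Finset.sum_filter]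
          exact (Finset.sum_subtype (p := fun T : Set F => ⟨b, hb⟩ ∈ T)
            (Finset.univ.filter fun T : Set F => ⟨b, hb⟩ ∈ T) (by simp)
            (fun T => (Z ω ∩ D (some T)).encard)).symm
        · intro T T' hne
          exact ((hDd (fun hc => hne (Subtype.ext (Option.some.inj hc)))).mono
            Set.inter_subset_right Set.inter_subset_right)
      rw [hsum, ← MeasurableSpace.comap_comp]
      refine MeasurableSpace.comap_mono ?_
      refine Measurable.comap_le ?_
      have : MeasurableAdd₂ ℕ∞ := ⟨measurable_of_countable _⟩
      refine Finset.measurable_sum _ fun T _ => ?_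
      split_ifs
      · exact measurable_pi_apply _
      · exact measurable_const
    · have : (fun ω => (Z ω ∩ B).encard) = (fun c : (({none} : Finset (Option (Set F)))) → ℕ∞ =>
            c ⟨none, by simp⟩) ∘ fun ω (i : ({none} : Finset (Option (Set F)))) =>
              (Z ω ∩ D i).encard := rfl
      rw [this, ← MeasurableSpace.comap_comp]
      exact MeasurableSpace.comap_mono (measurable_pi_apply _).comap_le
  · exact iSup₂_le fun b _ => (h.measurable_count b.1 b.2.1).comap_le
  · exact (h.measurable_count B hB).comap_le
  · intro F F'
    refine ⟨F ∪ F', ?_, ?_⟩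
    · exact biSup_mono fun b hb => Finset.mem_union_left _ hb
    · exact biSup_mono fun b hb => Finset.mem_union_right _ hb

lemma IsPoissonProcess.measure_count_eq_zero (h : IsPoissonProcess P ν Z) {B : Set S}
    (hB : MeasurableSet B) (hν : ν B ≠ ∞) :
    P {ω | Z ω ∩ B = ∅} = ENNReal.ofReal (Real.exp (-(ν B).toReal)) := by
  have h1 := congrArg (fun m => m {0}) (h.law_count B hB hν)
  rw [Measure.map_apply (h.measurable_count B hB) (MeasurableSet.of_discrete),
    Measure.map_apply (measurable_of_countable _) (MeasurableSet.of_discrete)] at h1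
  have e1 : (fun ω => (Z ω ∩ B).encard) ⁻¹' {0} = {ω | Z ω ∩ B = ∅} := by
    ext ω; simp
  have e2 : (Nat.cast : ℕ → ℕ∞) ⁻¹' {0} = {0} := by
    ext n; simp
  rw [e1, e2, poissonMeasure_singleton] at h1
  simpa [ENNReal.toReal] using h1

/-- A Poisson variable with parameter `r` exceeds `4 r` with probability at most `4 ^ (-r)`,
by Markov's inequality for `2 ^ X`. -/
lemma poissonMeasure_tail (r : ℕ) :
    poissonMeasure (r : ℝ≥0) {n | 4 * r < n} ≤ (4 : ℝ≥0∞)⁻¹ ^ r := by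
  have hexp : ∫⁻ n, (2 : ℝ≥0∞) ^ n ∂(poissonMeasure (r : ℝ≥0)) = ENNReal.ofReal (Real.exp r) := by
    rw [lintegral_countable']
    have hs : HasSum (fun n : ℕ => Real.exp (-r) * ((2 * r : ℝ) ^ n / (n.factorial : ℝ)))
        (Real.exp (-r) * Real.exp (2 * r)) := by
      have := (NormedSpace.expSeries_div_hasSum_exp (2 * r : ℝ))
      rw [← Real.exp_eq_exp_ℝ] at this
      exact this.mul_left _
    rw [← Real.exp_add] at hs
    have e : -(r : ℝ) + 2 * r = r := by ring
    rw [e] at hs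
    rw [← hs.tsum_eq, ENNReal.ofReal_tsum_of_nonneg (fun n => by positivity) hs.summable]
    refine tsum_congr fun n => ?_
    rw [poissonMeasure_singleton]
    have : (2 : ℝ≥0∞) ^ n = ENNReal.ofReal (2 ^ n) := by
      rw [ENNReal.ofReal_pow (by norm_num)]; norm_num
    rw [this, ← ENNReal.ofReal_mul (by positivity)]
    congr 1
    simp only [NNReal.coe_natCast]
    rw [mul_pow]; ring
  have hM := mul_meas_ge_le_lintegral (μ := poissonMeasure (r : ℝ≥0))
    (f := fun n => (2 : ℝ≥0∞) ^ n) (measurable_of_countable _) ((2 : ℝ≥0∞) ^ (4 * r))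
  rw [hexp] at hM
  have h16 : (2 : ℝ≥0∞) ^ (4 * r) = 4 ^ r * 4 ^ r := by
    rw [pow_mul, ← mul_pow]; norm_num
  have he : ENNReal.ofReal (Real.exp r) ≤ 4 ^ r := by
    have : Real.exp r ≤ 4 ^ r := by
      rw [← Real.exp_one_pow]
      gcongr
      exact Real.exp_one_lt_three.le.trans (by norm_num)
    refine (ENNReal.ofReal_le_ofReal this).trans ?_
    rw [ENNReal.ofReal_pow (by norm_num)]; norm_num
  have hsub : poissonMeasure (r : ℝ≥0) {n | 4 * r < n} ≤
      poissonMeasure (r : ℝ≥0) {n | (2 : ℝ≥0∞) ^ (4 * r) ≤ 2 ^ n} :=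
    measure_mono fun n (hn : 4 * r < n) =>
      (pow_le_pow_right₀ one_le_two hn.le : (2 : ℝ≥0∞) ^ (4 * r) ≤ 2 ^ n)
  refine hsub.trans ?_
  rw [h16] at hM ⊢
  have h3 := hM.trans he
  have h40 : (4 : ℝ≥0∞) ^ r ≠ 0 := by simp
  have h4t : (4 : ℝ≥0∞) ^ r ≠ ∞ := by simp
  rw [← ENNReal.inv_pow, ← mul_one ((4 : ℝ≥0∞) ^ r)⁻¹]
  rw [mul_assoc] at h3
  rw [← ENNReal.mul_le_mul_iff_right h40 h4t]
  refine (ENNReal.mul_le_mul_iff_right h40 h4t).1 ?_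
  refine h3.trans ?_
  rw [mul_one, ENNReal.mul_inv_cancel h40 h4t, mul_one]

/-- A set of mean `r` contains more than `4 r` points with probability at most `4 ^ (-r)`. -/
lemma IsPoissonProcess.measure_lt_count (h : IsPoissonProcess P ν Z) {B : Set S}
    (hB : MeasurableSet B) {r : ℕ} (hν : ν B = r) :
    P {ω | ((4 * r : ℕ) : ℕ∞) < (Z ω ∩ B).encard} ≤ (4 : ℝ≥0∞)⁻¹ ^ r := by
  have h1 := congrArg (fun m => m {n | ((4 * r : ℕ) : ℕ∞) < n}) (h.law_count B hB (by simp [hν]))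
  rw [Measure.map_apply (h.measurable_count B hB) (MeasurableSet.of_discrete),
    Measure.map_apply (measurable_of_countable _) (MeasurableSet.of_discrete)] at h1
  have e2 : (Nat.cast : ℕ → ℕ∞) ⁻¹' {n | ((4 * r : ℕ) : ℕ∞) < n} = {n | 4 * r < n} := by
    ext n; simp only [Set.mem_preimage, Set.mem_ofPred_eq, Nat.cast_lt]
  rw [e2, hν, ENNReal.toNNReal_natCast] at h1
  exact h1.trans_le (poissonMeasure_tail r)

end Poisson

/-! ### Clock families and their intensity -/

lemma atomVolume_prod_Ioc (s t : ℝ≥0) {a b : ℝ} (ha : 0 ≤ a) (hb : b ≤ 1) :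
    atomVolume (Set.Ioc s t ×ˢ {u : I | (u : ℝ) ∈ Set.Ioc a b}) =
      ENNReal.ofReal (t - s) * ENNReal.ofReal (b - a) := by
  rw [atomVolume, Measure.prod_prod]
  congr 1
  · rw [Measure.comap_apply _ NNReal.coe_injective (fun A hA =>
      NNReal.isClosedEmbedding_coe.measurableEmbedding.measurableSet_image.2 hA) _
      measurableSet_Ioc]
    have : ((↑) : ℝ≥0 → ℝ) '' Set.Ioc s t = Set.Ioc (s : ℝ) t := by
      ext x
      constructor
      · rintro ⟨y, ⟨h1, h2⟩, rfl⟩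
        exact ⟨by exact_mod_cast h1, by exact_mod_cast h2⟩
      · rintro ⟨h1, h2⟩
        exact ⟨⟨x, s.2.trans h1.le⟩, ⟨h1, h2⟩, rfl⟩
    rw [this, Real.volume_Ioc]
  · rw [Measure.Subtype.volume_def, comap_subtype_coe_apply measurableSet_Icc]
    have : (Subtype.val : I → ℝ) '' {u : I | (u : ℝ) ∈ Set.Ioc a b} = Set.Ioc a b := by
      ext x
      constructor
      · rintro ⟨y, h, rfl⟩
        exact h
      · rintro ⟨h1, h2⟩
        exact ⟨⟨x, ha.trans h1.le, h2.trans hb⟩, ⟨h1, h2⟩, rfl⟩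
    exact (congrArg _ this).trans Real.volume_Ioc

lemma measurableSet_marks (s t : ℝ≥0) (a b : ℝ) :
    MeasurableSet (Set.Ioc s t ×ˢ {u : I | (u : ℝ) ∈ Set.Ioc a b}) :=
  measurableSet_Ioc.prod (measurable_subtype_coe measurableSet_Ioc)

lemma measurableSet_upto (t : ℝ≥0) : MeasurableSet {p : Atom | p.1 ≤ t} :=
  measurable_fst measurableSet_Iic

lemma atomVolume_upto (t : ℝ≥0) : atomVolume {p : Atom | p.1 ≤ t} = t := by
  have h0 : {p : Atom | p.1 ≤ t} = Set.Iic t ×ˢ Set.univ := by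
    ext p; simp
  rw [h0, atomVolume, Measure.prod_prod, Measure.comap_apply _ NNReal.coe_injective (fun A hA =>
      NNReal.isClosedEmbedding_coe.measurableEmbedding.measurableSet_image.2 hA) _
      measurableSet_Iic]
  have : ((↑) : ℝ≥0 → ℝ) '' Set.Iic t = Set.Icc (0 : ℝ) t := by
    ext x
    constructor
    · rintro ⟨y, h, rfl⟩
      exact ⟨y.2, by exact_mod_cast h⟩
    · rintro ⟨h1, h2⟩
      exact ⟨⟨x, h1⟩, h2, rfl⟩
  rw [this, Real.volume_Icc]
  simp

/-- If `m₁` and `m₂` are independent sub-σ-algebras of `m`, and `m` is independent of `m₃`, then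
`m₁` is independent of `m₂ ⊔ m₃`. -/
lemma indep_sup_right {Ω : Type*} {m₁ m₂ m₃ m mΩ : MeasurableSpace Ω} {P : Measure Ω}
    [IsProbabilityMeasure P] (h₁ : m₁ ≤ m) (h₂ : m₂ ≤ m) (hm : m ≤ mΩ) (hm₃ : m₃ ≤ mΩ)
    (h₁₂ : Indep m₁ m₂ P) (h₃ : Indep m m₃ P) : Indep m₁ (m₂ ⊔ m₃) P := by
  let π : Set (Set Ω) := {t | ∃ A C, MeasurableSet[m₂] A ∧ MeasurableSet[m₃] C ∧ A ∩ C = t}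
  have hgen : m₂ ⊔ m₃ = MeasurableSpace.generateFrom π := by
    apply le_antisymm
    · refine sup_le ?_ ?_
      · intro A hA
        exact MeasurableSpace.measurableSet_generateFrom
          ⟨A, Set.univ, hA, @MeasurableSet.univ _ m₃, Set.inter_univ _⟩
      · intro C hC
        exact MeasurableSpace.measurableSet_generateFrom
          ⟨Set.univ, C, @MeasurableSet.univ _ m₂, hC, Set.univ_inter _⟩
    · refine MeasurableSpace.generateFrom_le ?_
      rintro t ⟨A, C, hA, hC, rfl⟩
      exact @MeasurableSet.inter _ (m₂ ⊔ m₃) _ _ ((le_sup_left : m₂ ≤ m₂ ⊔ m₃) A hA)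
        ((le_sup_right : m₃ ≤ m₂ ⊔ m₃) C hC)
  have hpi : IsPiSystem π := by
    rintro _ ⟨A, C, hA, hC, rfl⟩ _ ⟨A', C', hA', hC', rfl⟩ _
    exact ⟨A ∩ A', C ∩ C', @MeasurableSet.inter _ m₂ _ _ hA hA',
      @MeasurableSet.inter _ m₃ _ _ hC hC', by ext ω; simp only [Set.mem_inter_iff]; tauto⟩
  refine IndepSets.indep (p1 := {t | MeasurableSet[m₁] t}) (p2 := π) (h₁.trans hm)
    (sup_le (h₂.trans hm) hm₃) (@MeasurableSpace.isPiSystem_measurableSet _ m₁) hpi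
    (@MeasurableSpace.generateFrom_measurableSet _ m₁).symm hgen ?_
  rw [IndepSets_iff]
  rintro t _ ht ⟨A, C, hA, hC, rfl⟩
  rw [← Set.inter_assoc, (Indep_iff _ _ _).1 h₃ (t ∩ A) C
    (@MeasurableSet.inter _ m _ _ (h₁ t ht) (h₂ A hA)) hC, (Indep_iff _ _ _).1 h₃ A C (h₂ A hA) hC,
    (Indep_iff _ _ _).1 h₁₂ t A ht hA, mul_assoc]

section Clocks

variable {V Ω : Type*} [MeasurableSpace Ω] {P : Measure Ω} {clock : V → Ω → Set Atom}

/-- The σ-algebra generated by the clocks at the vertices in `W`. -/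
noncomputable abbrev clockSigma (clock : V → Ω → Set Atom) (W : Set V) : MeasurableSpace Ω :=
  ⨆ v ∈ W, pointSigma (clock v) Set.univ

lemma IsClockFamily.clockSigma_le (h : IsClockFamily P clock) (W : Set V) :
    clockSigma clock W ≤ ‹MeasurableSpace Ω› :=
  iSup₂_le fun v _ => (h.poisson v).pointSigma_le _

lemma IsClockFamily.clockHistory_le (h : IsClockFamily P clock) (t : ℝ≥0) :
    clockHistory clock t ≤ ‹MeasurableSpace Ω› :=
  iSup_le fun v => (h.poisson v).pointSigma_le _

omit [MeasurableSpace Ω] in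
lemma clockSigma_mono {W W' : Set V} (h : W ⊆ W') : clockSigma clock W ≤ clockSigma clock W' :=
  biSup_mono h

lemma IsClockFamily.indep_clockSigma (h : IsClockFamily P clock) {W W' : Set V}
    (hd : Disjoint W W') : Indep (clockSigma clock W) (clockSigma clock W') P :=
  indep_iSup_of_disjoint (fun v => (h.poisson v).pointSigma_le _) h.indep hd

/-- The σ-algebra generated by all the clocks except for the atoms of the clock of `x` after
time `s`. -/
noncomputable abbrev restSigma (clock : V → Ω → Set Atom) (x : V) (s : ℝ≥0) : MeasurableSpace Ω :=
  pointSigma (clock x) {p | p.1 ≤ s} ⊔ clockSigma clock {x}ᶜ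

lemma IsClockFamily.restSigma_le (h : IsClockFamily P clock) (x : V) (s : ℝ≥0) :
    restSigma clock x s ≤ ‹MeasurableSpace Ω› :=
  sup_le ((h.poisson x).pointSigma_le _) (h.clockSigma_le _)

omit [MeasurableSpace Ω] in
lemma clockHistory_le_restSigma (x : V) (s : ℝ≥0) :
    clockHistory clock s ≤ restSigma clock x s := by
  refine iSup_le fun v => ?_
  by_cases hv : v = x
  · subst hv
    exact le_sup_left
  · exact (pointSigma_mono (Set.subset_univ _)).trans
      ((le_iSup₂ (f := fun v (_ : v ∈ ({x}ᶜ : Set V)) => pointSigma (clock v) Set.univ) v hv).trans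
        le_sup_right)

/-- The atoms of the clock of `x` after time `s` are independent of everything else. -/
lemma IsClockFamily.indep_restSigma [IsProbabilityMeasure P] (h : IsClockFamily P clock)
    (x : V) (s : ℝ≥0) {B : Set Atom} (hB : MeasurableSet B) (hBs : ∀ p ∈ B, s < p.1) :
    Indep (MeasurableSpace.comap (fun ω => (clock x ω ∩ B).encard) inferInstance)
      (restSigma clock x s) P := by
  refine indep_sup_right (comap_count_le_pointSigma hB (Set.subset_univ _))
    (pointSigma_mono (Set.subset_univ _)) ((h.poisson x).pointSigma_le Set.univ)
    (h.clockSigma_le _) ?_ ?_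
  · exact (h.poisson x).indep_count_pointSigma hB
      (Set.disjoint_left.2 fun p hp hp' => (hBs p hp).not_ge hp')
  · have := h.indep_clockSigma (W := {x}) (W' := {x}ᶜ) disjoint_compl_right
    rwa [clockSigma, iSup_singleton] at this

end Clocks

/-! ### The Pólya rule -/

section Rule

variable {V : Type*} {G : SimpleGraph V} [G.LocallyFinite] {α : ℝ}
  {ord : ∀ v, Fin (G.degree v) ≃ G.neighborSet v}

lemma pol_nonneg (w : G.edgeSet → ℕ) (v : V) (e : G.edgeSet) :
    0 ≤ pol G α (fun e => (w e : ℝ)) v e :=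
  div_nonneg (by positivity) (Finset.sum_nonneg fun z _ => by positivity)

lemma sum_pol_le_one (w : G.edgeSet → ℕ) (v : V) (A : Finset (Fin (G.degree v))) :
    ∑ j ∈ A, pol G α (fun e => (w e : ℝ)) v (edgeTo G v (ord v j)) ≤ 1 := by
  refine (Finset.sum_le_sum_of_subset_of_nonneg (Finset.subset_univ A)
    fun j _ _ => pol_nonneg w v _).trans ?_
  simp only [pol]
  rw [← Finset.sum_div, Equiv.sum_comp (ord v) fun z => (w (edgeTo G v z) : ℝ) ^ α]
  exact div_self_le_one _

lemma pol_le_one (w : G.edgeSet → ℕ) (v : V) (i : Fin (G.degree v)) :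
    pol G α (fun e => (w e : ℝ)) v (edgeTo G v (ord v i)) ≤ 1 := by
  simpa using sum_pol_le_one (α := α) (ord := ord) w v {i}

/-- The atoms with time coordinate in `(s, t]` whose mark selects the slot `i` of `x` when the
weights are `w`. -/
def hitBox (G : SimpleGraph V) [G.LocallyFinite] (α : ℝ)
    (ord : ∀ v, Fin (G.degree v) ≃ G.neighborSet v) (s t : ℝ≥0) (w : G.edgeSet → ℕ) (x : V)
    (i : Fin (G.degree x)) : Set Atom :=
  Set.Ioc s t ×ˢ {u : I | (u : ℝ) ∈ markInterval G α ord (fun e => (w e : ℝ)) x i}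

lemma measurableSet_hitBox (s t : ℝ≥0) (w : G.edgeSet → ℕ) (x : V) (i : Fin (G.degree x)) :
    MeasurableSet (hitBox G α ord s t w x i) :=
  measurableSet_marks _ _ _ _

lemma atomVolume_hitBox (s t : ℝ≥0) (w : G.edgeSet → ℕ) (x : V) (i : Fin (G.degree x)) :
    atomVolume (hitBox G α ord s t w x i) =
      ENNReal.ofReal (t - s) *
        ENNReal.ofReal (pol G α (fun e => (w e : ℝ)) x (edgeTo G x (ord x i))) := by
  rw [hitBox, markInterval, atomVolume_prod_Ioc]
  · congr 2
    have : Finset.Iic i = insert i (Finset.Iio i) := by ext; simp [le_iff_eq_or_lt]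
    rw [this, Finset.sum_insert (by simp)]
    ring
  · exact Finset.sum_nonneg fun j _ => pol_nonneg w x _
  · exact sum_pol_le_one w x _

lemma pol_congr {w w' : G.edgeSet → ℕ} {x : V}
    (h : ∀ z : G.neighborSet x, w (edgeTo G x z) = w' (edgeTo G x z)) (z : G.neighborSet x) :
    pol G α (fun e => (w e : ℝ)) x (edgeTo G x z) =
      pol G α (fun e => (w' e : ℝ)) x (edgeTo G x z) := by
  simp only [pol, h]

lemma markInterval_congr {w w' : G.edgeSet → ℕ} {x : V}
    (h : ∀ z : G.neighborSet x, w (edgeTo G x z) = w' (edgeTo G x z)) (i : Fin (G.degree x)) :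
    markInterval G α ord (fun e => (w e : ℝ)) x i =
      markInterval G α ord (fun e => (w' e : ℝ)) x i := by
  simp only [markInterval, pol_congr h]

lemma hitBox_congr {w w' : G.edgeSet → ℕ} {x : V}
    (h : ∀ z : G.neighborSet x, w (edgeTo G x z) = w' (edgeTo G x z)) (s t : ℝ≥0)
    (i : Fin (G.degree x)) :
    hitBox G α ord s t w x i = hitBox G α ord s t w' x i := by
  simp only [hitBox, markInterval_congr h]

/-- If all the weights at `x` are at most `K` and the selected slot has weight at least `ρ K`,
then the slot is selected with probability bounded below in terms of `ρ` alone. -/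
lemma le_pol (hα : 0 ≤ α) {Δ : ℕ} (hΔ : ∀ v, G.degree v ≤ Δ) {w : G.edgeSet → ℕ} {x : V}
    {ρ K : ℝ} (hρ : 0 ≤ ρ) (hK : 0 < K) (z : G.neighborSet x)
    (hw : ∀ z : G.neighborSet x, (w (edgeTo G x z) : ℝ) ≤ K)
    (h1 : ∀ z : G.neighborSet x, 1 ≤ w (edgeTo G x z))
    (hz : ρ * K ≤ w (edgeTo G x z)) :
    ρ ^ α / Δ ≤ pol G α (fun e => (w e : ℝ)) x (edgeTo G x z) := by
  have hsum : ∑ z : G.neighborSet x, (w (edgeTo G x z) : ℝ) ^ α ≤ Δ * K ^ α := by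
    refine (Finset.sum_le_card_nsmul _ _ (K ^ α) fun z _ =>
      Real.rpow_le_rpow (by positivity) (hw z) hα).trans ?_
    rw [nsmul_eq_mul, Finset.card_univ, G.card_neighborSet_eq_degree]
    gcongr
    exact hΔ x
  have hpos : 0 < ∑ z : G.neighborSet x, (w (edgeTo G x z) : ℝ) ^ α := by
    refine Finset.sum_pos (fun z _ => Real.rpow_pos_of_pos ?_ _) ⟨z, Finset.mem_univ _⟩
    exact_mod_cast h1 z
  have hKα : 0 < K ^ α := Real.rpow_pos_of_pos hK _
  have hΔ0 : 0 < (Δ : ℝ) := by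
    by_contra h
    have : (Δ : ℝ) = 0 := le_antisymm (not_lt.1 h) (by positivity)
    rw [this, zero_mul] at hsum
    exact absurd hpos hsum.not_gt
  rw [pol, div_le_div_iff₀ hΔ0 hpos]
  calc ρ ^ α * ∑ z : G.neighborSet x, (w (edgeTo G x z) : ℝ) ^ α
      ≤ ρ ^ α * (Δ * K ^ α) := by gcongr
    _ = (ρ * K) ^ α * Δ := by rw [Real.mul_rpow hρ hK.le]; ring
    _ ≤ _ := by gcongr

end Rule

/-! ### Trajectories of the weights -/

/-- The realisations of the clocks and weights for which the update rule holds at all times and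
only finitely many atoms occur in bounded time at each vertex. -/
structure IsTrajectory {V : Type*} (G : SimpleGraph V) [G.LocallyFinite] (α : ℝ)
    (ord : ∀ v, Fin (G.degree v) ≃ G.neighborSet v) (Z : V → Set Atom)
    (n : ℝ≥0 → G.edgeSet → ℕ) : Prop where
  dynamics : ∀ t e, (n t e : ℕ∞) = 1 + (reinforcements G α ord Z n t e).encard
  finite : ∀ v t, (Z v ∩ {p | p.1 ≤ t}).Finite

section Trajectory

variable {V : Type*} {G : SimpleGraph V} [G.LocallyFinite] {α : ℝ}
  {ord : ∀ v, Fin (G.degree v) ≃ G.neighborSet v} {Z : V → Set Atom} {n : ℝ≥0 → G.edgeSet → ℕ}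

lemma reinforcements_mono {s t : ℝ≥0} (h : s ≤ t) (e : G.edgeSet) :
    reinforcements G α ord Z n s e ⊆ reinforcements G α ord Z n t e :=
  fun _ hq => ⟨hq.1, hq.2.1.trans h, hq.2.2⟩

lemma mem_edge_of_mem_reinforcements {t : ℝ≥0} {e : G.edgeSet} {q : V × Atom}
    (hq : q ∈ reinforcements G α ord Z n t e) : q.1 ∈ e.1 := by
  obtain ⟨-, -, i, rfl, -⟩ := hq
  exact Sym2.mem_mk_left _ _

namespace IsTrajectory

variable (h : IsTrajectory G α ord Z n)

include h

lemma one_le (t : ℝ≥0) (e : G.edgeSet) : 1 ≤ n t e := by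
  have := h.dynamics t e
  exact_mod_cast (le_self_add.trans_eq this.symm : (1 : ℕ∞) ≤ n t e)

lemma mono {s t : ℝ≥0} (hst : s ≤ t) (e : G.edgeSet) : n s e ≤ n t e := by
  have : (n s e : ℕ∞) ≤ n t e := by
    rw [h.dynamics s e, h.dynamics t e]
    gcongr
    exact reinforcements_mono hst e
  exact_mod_cast this

lemma le_of_counts {t : ℝ≥0} {c : ℕ} (x : V) (z : G.neighborSet x)
    (hx : (Z x ∩ {p | p.1 ≤ t}).encard ≤ c) (hz : (Z z ∩ {p | p.1 ≤ t}).encard ≤ c) :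
    n t (edgeTo G x z) ≤ 1 + 2 * c := by
  have hsub : reinforcements G α ord Z n t (edgeTo G x z) ⊆
      Prod.mk x '' (Z x ∩ {p | p.1 ≤ t}) ∪ Prod.mk z.1 '' (Z z ∩ {p | p.1 ≤ t}) := by
    rintro ⟨v, p⟩ hq
    have hv := mem_edge_of_mem_reinforcements hq
    rcases Sym2.mem_iff.1 (show v ∈ s(x, z.1) from hv) with rfl | rfl
    · exact Or.inl ⟨p, ⟨hq.1, hq.2.1⟩, rfl⟩
    · exact Or.inr ⟨p, ⟨hq.1, hq.2.1⟩, rfl⟩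
  have : (n t (edgeTo G x z) : ℕ∞) ≤ ((1 + 2 * c : ℕ) : ℕ∞) := by
    rw [h.dynamics]
    push_cast
    gcongr
    refine (Set.encard_le_encard hsub).trans ((Set.encard_union_le _ _).trans ?_)
    rw [two_mul]
    exact add_le_add ((Set.encard_image_le _ _).trans hx) ((Set.encard_image_le _ _).trans hz)
  exact_mod_cast this

lemma eq_of_no_atom {s t : ℝ≥0} (hst : s ≤ t) {e : G.edgeSet}
    (hno : ∀ v ∈ e.1, ∀ p ∈ Z v, s < p.1 → ¬ p.1 ≤ t) : n s e = n t e := by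
  have : reinforcements G α ord Z n s e = reinforcements G α ord Z n t e := by
    refine (reinforcements_mono hst e).antisymm fun q hq => ⟨hq.1, ?_, hq.2.2⟩
    by_contra hlt
    exact hno q.1 (mem_edge_of_mem_reinforcements hq) q.2 hq.1 (not_le.1 hlt) hq.2.1
  have h2 : (n s e : ℕ∞) = n t e := by rw [h.dynamics s e, h.dynamics t e, this]
  exact_mod_cast h2

lemma leftLim_eq {s t : ℝ≥0} (hst : s < t) {e : G.edgeSet}
    (hno : ∀ v ∈ e.1, ∀ p ∈ Z v, s < p.1 → ¬ p.1 < t) :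
    Function.leftLim (fun r => n r e) t = n s e := by
  have hne : (nhdsWithin t (Set.Iio t)).NeBot := nhdsLT_neBot_of_exists_lt ⟨s, hst⟩
  refine leftLim_eq_of_tendsto ?_
  refine tendsto_const_nhds.congr' ?_
  filter_upwards [Ioo_mem_nhdsLT hst] with r hr
  exact h.eq_of_no_atom hr.1.le fun v hv p hp hsp hpr => hno v hv p hp hsp (hpr.trans_lt hr.2)

/-- An atom of the clock of `x` whose mark selects the slot `i` for the weights at an earlier time
`s` is a true selection, provided no neighbour rang in between. -/
lemma mem_reinforcements_of_mem_hitBox {s r t : ℝ≥0} {x : V} {i : Fin (G.degree x)} {p : Atom}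
    (hp : p ∈ Z x) (hbox : p ∈ hitBox G α ord s r (n s) x i) (hpt : p.1 ≤ t)
    (hno : ∀ v, v = x ∨ G.Adj x v → ∀ q ∈ Z v, s < q.1 → ¬ q.1 < p.1) :
    (x, p) ∈ reinforcements G α ord Z n t (edgeTo G x (ord x i)) := by
  refine ⟨hp, hpt, i, rfl, ?_⟩
  have hsp : s < p.1 := hbox.1.1
  have hm := hbox.2
  have : ∀ z : G.neighborSet x,
      Function.leftLim (fun r => n r (edgeTo G x z)) p.1 = n s (edgeTo G x z) := by
    intro z
    refine h.leftLim_eq hsp fun v hv q hq => hno v ?_ q hq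
    rcases Sym2.mem_iff.1 (show v ∈ s(x, z.1) from hv) with rfl | rfl
    · exact Or.inl rfl
    · exact Or.inr z.2
  rw [markInterval_congr (w := fun e' => Function.leftLim (fun r => n r e') p.1) (w' := n s) this]
  exact hm

/-- The times of the atoms near `x` up to time `T` are separated by a positive gap. -/
lemma exists_gap (x : V) (T : ℝ≥0) :
    ∃ h₀ : ℝ≥0, 0 < h₀ ∧ ∀ v, v = x ∨ G.Adj x v → ∀ w, w = x ∨ G.Adj x w →
      ∀ p ∈ Z v, ∀ q ∈ Z w, p.1 ≤ T → q.1 < p.1 → q.1 + h₀ ≤ p.1 := by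
  let A : Set ℝ≥0 := ⋃ v ∈ insert x (G.neighborSet x), Prod.fst '' (Z v ∩ {p | p.1 ≤ T})
  have hA : A.Finite := by
    refine Set.Finite.biUnion ((Set.toFinite (G.neighborSet x)).insert x) fun v _ => ?_
    exact (h.finite v T).image _
  let D : Set (ℝ≥0 × ℝ≥0) := {y | y ∈ A ×ˢ A ∧ y.2 < y.1}
  have hD : D.Finite := (hA.prod hA).subset fun y hy => hy.1
  have hmem : ∀ v, v = x ∨ G.Adj x v → ∀ p ∈ Z v, p.1 ≤ T → p.1 ∈ A := by
    intro v hv p hp hpT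
    refine Set.mem_biUnion (x := v) ?_ ⟨p, ⟨hp, hpT⟩, rfl⟩
    rcases hv with rfl | hv
    · exact Set.mem_insert _ _
    · exact Set.mem_insert_of_mem _ hv
  obtain ⟨h₀, hpos, hle⟩ : ∃ h₀ : ℝ≥0, 0 < h₀ ∧ ∀ y ∈ D, h₀ ≤ y.1 - y.2 := by
    rcases D.eq_empty_or_nonempty with hE | hE
    · exact ⟨1, one_pos, by simp [hE]⟩
    · obtain ⟨y, hy, hmin⟩ := Set.exists_min_image D (fun y => y.1 - y.2) hD hE
      exact ⟨y.1 - y.2, tsub_pos_of_lt hy.2, hmin⟩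
  refine ⟨h₀, hpos, fun v hv w hw p hp q hq hpT hqp => ?_⟩
  have := hle (p.1, q.1) ⟨⟨hmem v hv p hp hpT, hmem w hw q hq (hqp.le.trans hpT)⟩, hqp⟩
  rw [add_comm]
  exact (add_le_add_left this _).trans_eq (tsub_add_cancel_of_le hqp.le)

end IsTrajectory

/-- The `m`-th time of the grid of mesh `2 ^ (-j)`. -/
noncomputable def gridTime (j m : ℕ) : ℝ≥0 := m / 2 ^ j

lemma gridTime_mono (j : ℕ) : Monotone (gridTime j) := fun a b hab => by
  unfold gridTime; gcongr

lemma gridTime_pow (j k : ℕ) : gridTime j (2 ^ (k + j)) = 2 ^ k := by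
  rw [gridTime, pow_add]; push_cast
  field_simp

lemma gridTime_succ (j m : ℕ) : gridTime j (m + 1) = gridTime j m + (2 ^ j)⁻¹ := by
  rw [gridTime, gridTime, Nat.cast_succ, add_div, one_div]

open Classical in
/-- On a fine grid, the number of cells that contain an atom selecting a slot for the weights at
the beginning of the cell is bounded by the growth of the weight of the slot. -/
lemma IsTrajectory.eventually_card_add_le (h : IsTrajectory G α ord Z n) (x : V)
    (i : Fin (G.degree x)) (k : ℕ) : ∀ᶠ j in atTop,
      ((Finset.Ico (2 ^ (k + j)) (2 ^ (k + 1 + j))).filter fun m =>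
          (Z x ∩ hitBox G α ord (gridTime j m) (gridTime j (m + 1)) (n (gridTime j m)) x i).Nonempty
        ).card + n (2 ^ k) (edgeTo G x (ord x i)) ≤ n (2 ^ (k + 1)) (edgeTo G x (ord x i)) := by
  obtain ⟨h₀, hpos, hgap⟩ := h.exists_gap x (2 ^ (k + 1))
  have hev : ∀ᶠ j : ℕ in atTop, ((2 : ℝ≥0) ^ j)⁻¹ < h₀ := by
    have : Tendsto (fun j : ℕ => ((2 : ℝ≥0) ^ j)⁻¹) atTop (nhds 0) := by
      simp_rw [← inv_pow]
      exact NNReal.tendsto_pow_atTop_nhds_zero_of_lt_one (inv_lt_one_of_one_lt₀ one_lt_two)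
    exact this.eventually_lt_const hpos
  filter_upwards [hev] with j hj
  set e := edgeTo G x (ord x i)
  set M := (Finset.Ico (2 ^ (k + j)) (2 ^ (k + 1 + j))).filter fun m =>
    (Z x ∩ hitBox G α ord (gridTime j m) (gridTime j (m + 1)) (n (gridTime j m)) x i).Nonempty
    with hM
  have hex : ∀ m : M, ∃ p, p ∈ Z x ∧
      p ∈ hitBox G α ord (gridTime j m) (gridTime j (m + 1)) (n (gridTime j m)) x i :=
    fun m => (Finset.mem_filter.1 m.2).2
  choose p hpZ hpbox using hex
  have hlt : ∀ m : M, gridTime j m < (p m).1 := fun m => (hpbox m).1.1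
  have hle : ∀ m : M, (p m).1 ≤ gridTime j (m + 1) := fun m => (hpbox m).1.2
  have hIco : ∀ m : M, 2 ^ (k + j) ≤ m.1 ∧ m.1 < 2 ^ (k + 1 + j) :=
    fun m => Finset.mem_Ico.1 (Finset.mem_filter.1 m.2).1
  have hpT : ∀ m : M, (p m).1 ≤ 2 ^ (k + 1) := fun m => by
    rw [← gridTime_pow j (k + 1)]
    exact (hle m).trans (gridTime_mono j (hIco m).2)
  have hinj : Function.Injective fun m : M => (x, p m) := by
    have : ∀ m m' : M, m.1 < m'.1 → p m ≠ p m' := fun m m' hmm heq => by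
      have h1 := (hle m).trans (gridTime_mono j (Nat.succ_le_of_lt hmm))
      rw [heq] at h1
      exact absurd (hlt m') h1.not_gt
    intro m m' heq
    have heq' : p m = p m' := (Prod.mk.inj heq).2
    rcases lt_trichotomy m.1 m'.1 with hc | hc | hc
    · exact (this _ _ hc heq').elim
    · exact Subtype.ext hc
    · exact (this _ _ hc heq'.symm).elim
  have hreinf : ∀ m : M, (x, p m) ∈ reinforcements G α ord Z n (2 ^ (k + 1)) e := by
    intro m
    refine h.mem_reinforcements_of_mem_hitBox (hpZ m) (hpbox m) (hpT m) ?_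
    intro v hv q hq hsq hqp
    have h1 := hgap x (Or.inl rfl) v hv (p m) (hpZ m) q hq (hpT m) hqp
    have h2 := hle m
    rw [gridTime_succ] at h2
    exact absurd (h1.trans h2) (not_le.2 (add_lt_add hsq hj))
  have hdisj : Disjoint (Set.range fun m : M => (x, p m))
      (reinforcements G α ord Z n (2 ^ k) e) := by
    refine Set.disjoint_left.2 ?_
    rintro _ ⟨m, rfl⟩ hq
    have h1 : (p m).1 ≤ 2 ^ k := hq.2.1
    rw [← gridTime_pow j k] at h1
    exact absurd ((gridTime_mono j (hIco m).1).trans_lt (hlt m)) h1.not_gt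
  have hsub : (Set.range fun m : M => (x, p m)) ∪ reinforcements G α ord Z n (2 ^ k) e ⊆
      reinforcements G α ord Z n (2 ^ (k + 1)) e :=
    Set.union_subset (by rintro _ ⟨m, rfl⟩; exact hreinf m)
      (reinforcements_mono (pow_le_pow_right₀ one_le_two (Nat.le_succ k)) e)
  have hcard : (Set.range fun m : M => (x, p m)).encard = M.card := by
    rw [← Set.image_univ, hinj.encard_image, Set.encard_univ]
    simp
  have hfin : ((M.card + n (2 ^ k) e : ℕ) : ℕ∞) ≤ n (2 ^ (k + 1)) e := by
    push_cast
    rw [h.dynamics (2 ^ k) e, h.dynamics (2 ^ (k + 1)) e, ← hcard, add_left_comm,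
      ← Set.encard_union_eq hdisj]
    gcongr
  exact_mod_cast hfin

end Trajectory

/-! ### The exponential moment of one cell -/

section OneCell

variable {V Ω : Type*} [MeasurableSpace Ω] {P : Measure Ω} {clock : V → Ω → Set Atom}
  {G : SimpleGraph V} [G.LocallyFinite] {α : ℝ}
  {ord : ∀ v, Fin (G.degree v) ≃ G.neighborSet v} {M : Ω → G.edgeSet → ℕ}

/-- The weights `d` of the slots of `x`, extended by zero to all edges. -/
noncomputable def slotExtend (ord : ∀ v, Fin (G.degree v) ≃ G.neighborSet v) (x : V)
    (d : Fin (G.degree x) → ℕ) (e : G.edgeSet) : ℕ :=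
  open Classical in if h : ∃ i, edgeTo G x (ord x i) = e then d h.choose else 0

lemma slotExtend_slots (w : G.edgeSet → ℕ) (x : V) (z : G.neighborSet x) :
    slotExtend ord x (fun i => w (edgeTo G x (ord x i))) (edgeTo G x z) = w (edgeTo G x z) := by
  have h : ∃ i, edgeTo G x (ord x i) = edgeTo G x z := ⟨(ord x).symm z, by simp⟩
  rw [slotExtend, dif_pos h]
  exact congrArg w h.choose_spec

open Classical in
/-- The weight `1/2` if some atom of the clock of `x` with time in `(s, t]` selects the slot `i` for
the weights `w`, and `1` otherwise. -/
noncomputable def hitFactor (G : SimpleGraph V) [G.LocallyFinite] (α : ℝ)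
    (ord : ∀ v, Fin (G.degree v) ≃ G.neighborSet v) (clock : V → Ω → Set Atom)
    (s t : ℝ≥0) (x : V) (i : Fin (G.degree x)) (w : G.edgeSet → ℕ) (ω : Ω) : ℝ≥0∞ :=
  if (clock x ω ∩ hitBox G α ord s t w x i).Nonempty then 2⁻¹ else 1

open Classical in
/-- The hit factor for the random weights `M`, killed when the selection probability of the slot
is below `p`. -/
noncomputable def cellFactor (G : SimpleGraph V) [G.LocallyFinite] (α : ℝ)
    (ord : ∀ v, Fin (G.degree v) ≃ G.neighborSet v) (clock : V → Ω → Set Atom)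
    (M : Ω → G.edgeSet → ℕ) (p : ℝ) (s t : ℝ≥0) (x : V) (i : Fin (G.degree x)) (ω : Ω) : ℝ≥0∞ :=
  if p ≤ pol G α (fun e => (M ω e : ℝ)) x (edgeTo G x (ord x i)) then
    hitFactor G α ord clock s t x i (M ω) ω else 0

omit [MeasurableSpace Ω] in
lemma cellFactor_congr {M' : Ω → G.edgeSet → ℕ} {x : V} {ω : Ω}
    (h : ∀ z : G.neighborSet x, M ω (edgeTo G x z) = M' ω (edgeTo G x z)) (p : ℝ) (s t : ℝ≥0)
    (i : Fin (G.degree x)) :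
    cellFactor G α ord clock M p s t x i ω = cellFactor G α ord clock M' p s t x i ω := by
  simp only [cellFactor, hitFactor, pol_congr h]
  rw [hitBox_congr (w := M ω) (w' := M' ω) h]

omit [MeasurableSpace Ω] in
lemma hitFactor_eq_comp (s t : ℝ≥0) (x : V) (i : Fin (G.degree x)) (w : G.edgeSet → ℕ) :
    hitFactor G α ord clock s t x i w = (fun c : ℕ∞ => if c = 0 then (1 : ℝ≥0∞) else 2⁻¹) ∘
      fun ω => (clock x ω ∩ hitBox G α ord s t w x i).encard := by
  funext ω
  simp only [hitFactor, Function.comp, Set.encard_eq_zero, Set.nonempty_iff_ne_empty, ite_not]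

omit [MeasurableSpace Ω] in
lemma measurable_hitFactor {m : MeasurableSpace Ω} {s t : ℝ≥0} {x : V}
    (hm : pointSigma (clock x) {p | p.1 ≤ t} ≤ m) (i : Fin (G.degree x)) (w : G.edgeSet → ℕ) :
    Measurable[m] (hitFactor G α ord clock s t x i w) := by
  have h1 : Measurable[m] fun ω => (clock x ω ∩ hitBox G α ord s t w x i).encard :=
    (measurable_count_pointSigma (measurableSet_hitBox s t w x i)
      (fun p hp => hp.1.2)).mono hm le_rfl
  rw [hitFactor_eq_comp]
  exact (measurable_of_countable _).comp h1

omit [MeasurableSpace Ω] in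
lemma cellFactor_eq_slotExtend (p : ℝ) (s t : ℝ≥0) (x : V) (i : Fin (G.degree x)) (ω : Ω) :
    cellFactor G α ord clock M p s t x i ω =
      cellFactor G α ord clock
        (fun _ => slotExtend ord x fun i => M ω (edgeTo G x (ord x i))) p s t x i ω :=
  cellFactor_congr (fun z => (slotExtend_slots (M ω) x z).symm) p s t i

omit [MeasurableSpace Ω] in
lemma measurable_cellFactor {m : MeasurableSpace Ω} {s t : ℝ≥0} {x : V}
    (hm : pointSigma (clock x) {p | p.1 ≤ t} ≤ m) (hM : ∀ e, Measurable[m] fun ω => M ω e)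
    (p : ℝ) (i : Fin (G.degree x)) :
    Measurable[m] (cellFactor G α ord clock M p s t x i) := by
  let Φ : (Fin (G.degree x) → ℕ) × Ω → ℝ≥0∞ := fun y =>
    cellFactor G α ord clock (fun _ => slotExtend ord x y.1) p s t x i y.2
  have hΦ : Measurable Φ := by
    refine measurable_from_prod_countable_right fun d => ?_
    change Measurable fun ω => cellFactor G α ord clock (fun _ => slotExtend ord x d) p s t x i ω
    by_cases hd : p ≤ pol G α (fun e => (slotExtend ord x d e : ℝ)) x (edgeTo G x (ord x i))
    · simp only [cellFactor, if_pos hd]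
      exact measurable_hitFactor hm i _
    · simp only [cellFactor, if_neg hd]
      exact measurable_const
  have hD : Measurable fun ω => ((fun i => M ω (edgeTo G x (ord x i))), ω) :=
    (measurable_pi_lambda _ fun i => hM _).prodMk measurable_id
  have : cellFactor G α ord clock M p s t x i =
      Φ ∘ fun ω => ((fun i => M ω (edgeTo G x (ord x i))), ω) := by
    funext ω
    exact cellFactor_eq_slotExtend p s t x i ω
  rw [this]
  exact hΦ.comp hD

lemma lintegral_hitFactor_le [IsProbabilityMeasure P] (h : IsClockFamily P clock) {s t : ℝ≥0}
    (hst : s ≤ t) (ht : t ≤ s + 1) {p : ℝ} (hp : 0 ≤ p) (x : V) (i : Fin (G.degree x))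
    (w : G.edgeSet → ℕ) (hw : p ≤ pol G α (fun e => (w e : ℝ)) x (edgeTo G x (ord x i))) :
    ∫⁻ ω, hitFactor G α ord clock s t x i w ω ∂P ≤ ENNReal.ofReal (1 - (t - s) * p / 4) := by
  set q := pol G α (fun e => (w e : ℝ)) x (edgeTo G x (ord x i)) with hq
  have hq1 : q ≤ 1 := pol_le_one w x i
  have hB := measurableSet_hitBox (α := α) (ord := ord) s t w x i
  have hvol := atomVolume_hitBox (α := α) (ord := ord) s t w x i
  set B := hitBox G α ord s t w x i with hBdef
  have hst' : (0 : ℝ) ≤ t - s := sub_nonneg.2 (by exact_mod_cast hst)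
  have ht' : (t : ℝ) - s ≤ 1 := by
    have : (t : ℝ) ≤ s + 1 := by exact_mod_cast ht
    linarith
  have hvol' : (atomVolume B).toReal = (t - s) * q := by
    rw [hvol, ENNReal.toReal_mul, ENNReal.toReal_ofReal hst',
      ENNReal.toReal_ofReal (hp.trans hw)]
  have hemp := (h.poisson x).measure_count_eq_zero hB
    (by rw [hvol]; exact ENNReal.mul_ne_top ENNReal.ofReal_ne_top ENNReal.ofReal_ne_top)
  have hmeas : MeasurableSet {ω | clock x ω ∩ B = ∅} := by
    have := (h.poisson x).measurable_count B hB (MeasurableSet.of_discrete (s := {0}))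
    simpa [Set.preimage] using this
  have hfun : ∀ ω, hitFactor G α ord clock s t x i w ω =
      2⁻¹ + Set.indicator {ω | clock x ω ∩ B = ∅} (fun _ => 2⁻¹) ω := by
    intro ω
    by_cases hc : clock x ω ∩ B = ∅
    · rw [hitFactor, if_neg (by rw [← hBdef, hc]; exact Set.not_nonempty_empty),
        Set.indicator_of_mem (by exact hc), ENNReal.inv_two_add_inv_two]
    · rw [hitFactor, if_pos (Set.nonempty_iff_ne_empty.2 hc), Set.indicator_of_notMem (by exact hc),
        add_zero]
  simp_rw [hfun]
  rw [lintegral_add_left measurable_const, lintegral_indicator_const hmeas, lintegral_const,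
    measure_univ, mul_one, hemp, hvol']
  have h2 : (2 : ℝ≥0∞)⁻¹ = ENNReal.ofReal (1 / 2) := by
    rw [one_div, ENNReal.ofReal_inv_of_pos (by norm_num)]; norm_num
  rw [h2, ← ENNReal.ofReal_mul (by norm_num), ← ENNReal.ofReal_add (by norm_num) (by positivity)]
  refine ENNReal.ofReal_le_ofReal ?_
  set y := (t - s : ℝ) * q with hy
  have hy0 : (t - s : ℝ) * p ≤ y := by rw [hy]; gcongr
  have hy00 : 0 ≤ y := le_trans (by positivity) hy0
  have hy1 : y ≤ 1 := mul_le_one₀ ht' (hp.trans hw) hq1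
  have hexp : Real.exp (-y) ≤ 1 - y / 2 := by
    -- convexity of the exponential on `[0, 1]`, in the form `exp (-y) ≤ 1 / (1 + y)`
    have h1 : Real.exp (-y) ≤ 1 / (1 + y) := by
      rw [Real.exp_neg, ← one_div]
      exact one_div_le_one_div_of_le (by linarith) (by linarith [Real.add_one_le_exp y])
    refine h1.trans ?_
    rw [div_le_iff₀ (by linarith)]
    nlinarith
  linarith

/-- The one-cell estimate: conditionally on everything but the atoms of `x` after time `s`, the
cell factor has mean at most `1 - (t - s) p / 4`. -/
lemma lintegral_mul_cellFactor_le [IsProbabilityMeasure P] (h : IsClockFamily P clock) {s t : ℝ≥0}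
    (hst : s ≤ t) (ht : t ≤ s + 1) {p : ℝ} (hp : 0 ≤ p) (x : V) (i : Fin (G.degree x))
    (hM : ∀ e, Measurable[clockHistory clock s] fun ω => M ω e) {F : Ω → ℝ≥0∞}
    (hF : Measurable[restSigma clock x s] F) :
    ∫⁻ ω, F ω * cellFactor G α ord clock M p s t x i ω ∂P ≤
      ENNReal.ofReal (1 - (t - s) * p / 4) * ∫⁻ ω, F ω ∂P := by
  set D : Ω → (Fin (G.degree x) → ℕ) := fun ω i => M ω (edgeTo G x (ord x i)) with hD
  have hDm : Measurable[restSigma clock x s] D :=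
    @measurable_pi_lambda _ _ _ (restSigma clock x s) _ _
      fun i => (hM _).mono (clockHistory_le_restSigma x s) le_rfl
  have hfib : ∀ d, MeasurableSet[restSigma clock x s] (D ⁻¹' {d}) :=
    fun d => hDm (MeasurableSet.of_discrete)
  have hle := h.restSigma_le x s
  have hsplit : ∀ f : Ω → ℝ≥0∞, ∫⁻ ω, f ω ∂P = ∑' d, ∫⁻ ω in D ⁻¹' {d}, f ω ∂P := by
    intro f
    rw [← lintegral_iUnion (fun d => hle _ (hfib d))
      (fun d d' hne => Disjoint.preimage _ (Set.disjoint_singleton.2 hne))]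
    have : (⋃ d, D ⁻¹' {d}) = Set.univ := by ext; simp
    rw [this, Measure.restrict_univ]
  -- the weights at `x` take countably many values, and are constant on each part of the sum
  rw [hsplit, hsplit F, ← ENNReal.tsum_mul_left]
  refine ENNReal.tsum_le_tsum fun d => ?_
  by_cases hd : p ≤ pol G α (fun e => (slotExtend ord x d e : ℝ)) x (edgeTo G x (ord x i))
  · have hind : ∀ f : Ω → ℝ≥0∞, ∫⁻ ω in D ⁻¹' {d}, f ω ∂P =
        ∫⁻ ω, (D ⁻¹' {d}).indicator f ω ∂P := fun f => (lintegral_indicator (hle _ (hfib d)) f).symm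
    rw [hind, hind F]
    have heq : (D ⁻¹' {d}).indicator (fun ω => F ω * cellFactor G α ord clock M p s t x i ω) =
        fun ω => (D ⁻¹' {d}).indicator F ω *
          hitFactor G α ord clock s t x i (slotExtend ord x d) ω := by
      funext ω
      by_cases hω : ω ∈ D ⁻¹' {d}
      · rw [Set.indicator_of_mem hω, Set.indicator_of_mem hω]
        have : D ω = d := hω
        rw [cellFactor_eq_slotExtend]
        change F ω * cellFactor G α ord clock (fun _ => slotExtend ord x (D ω)) p s t x i ω = _
        rw [this, cellFactor, if_pos hd]
      · rw [Set.indicator_of_notMem hω, Set.indicator_of_notMem hω, zero_mul]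
    rw [heq]
    have hprod := lintegral_mul_eq_lintegral_mul_lintegral_of_independent_measurableSpace
      (μ := P) hle ((h.poisson x).measurable_count _
        (measurableSet_hitBox (α := α) (ord := ord) s t (slotExtend ord x d) x i)).comap_le
      (h.indep_restSigma x s
        (measurableSet_hitBox (α := α) (ord := ord) s t (slotExtend ord x d) x i)
        (fun p hp => hp.1.1)).symm (f := (D ⁻¹' {d}).indicator F)
      (g := hitFactor G α ord clock s t x i (slotExtend ord x d))
      (hF.indicator (hfib d)) ?_
    · rw [hprod, mul_comm]
      gcongr
      exact lintegral_hitFactor_le h hst ht hp x i _ hd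
    · rw [hitFactor_eq_comp]
      exact (measurable_of_countable _).comp (comap_measurable _)
  · rw [setLIntegral_congr_fun (g := fun _ => 0) (hle _ (hfib d)) ?_]
    · simp
    · intro ω hω
      have : D ω = d := hω
      simp only
      rw [cellFactor_eq_slotExtend]
      change F ω * cellFactor G α ord clock (fun _ => slotExtend ord x (D ω)) p s t x i ω = _
      rw [this, cellFactor, if_neg hd, mul_zero]

end OneCell

/-! ### Joint exponential moments on a grid -/

section Joint

variable {V Ω : Type*} [MeasurableSpace Ω] {P : Measure Ω} [IsProbabilityMeasure P]
  {clock : V → Ω → Set Atom}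
  {G : SimpleGraph V} [G.LocallyFinite] {α : ℝ}
  {ord : ∀ v, Fin (G.degree v) ≃ G.neighborSet v} {M : ℝ≥0 → Ω → G.edgeSet → ℕ}
  {ι : Type*} [DecidableEq ι] {x : ι → V} {i : ∀ a, Fin (G.degree (x a))} {k : ι → ℕ} {p : ℝ}
  {j : ℕ}

/-- The factor of the `m`-th cell of the grid of mesh `2 ^ (-j)` for the slot with index `a`; it is
trivial outside of the time window `[2 ^ k a, 2 ^ (k a + 1))`. -/
noncomputable def windowFactor (G : SimpleGraph V) [G.LocallyFinite] (α : ℝ)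
    (ord : ∀ v, Fin (G.degree v) ≃ G.neighborSet v) (clock : V → Ω → Set Atom)
    (M : ℝ≥0 → Ω → G.edgeSet → ℕ) (x : ι → V) (i : ∀ a, Fin (G.degree (x a))) (k : ι → ℕ) (p : ℝ)
    (j m : ℕ) (a : ι) (ω : Ω) : ℝ≥0∞ :=
  if m ∈ Finset.Ico (2 ^ (k a + j)) (2 ^ (k a + 1 + j)) then
    cellFactor G α ord clock (M (gridTime j m)) p (gridTime j m) (gridTime j (m + 1)) (x a) (i a) ω
  else 1

/-- The bound for the mean of the window factor. -/
noncomputable def windowMean (k : ι → ℕ) (p : ℝ) (j m : ℕ) (a : ι) : ℝ≥0∞ :=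
  if m ∈ Finset.Ico (2 ^ (k a + j)) (2 ^ (k a + 1 + j)) then
    ENNReal.ofReal (1 - (2 ^ j)⁻¹ * p / 4) else 1

omit [MeasurableSpace Ω] [DecidableEq ι] in
lemma measurable_windowFactor {m' : MeasurableSpace Ω} {m : ℕ} {a : ι}
    (hm : pointSigma (clock (x a)) {q | q.1 ≤ gridTime j (m + 1)} ≤ m')
    (hM : ∀ e, Measurable[m'] fun ω => M (gridTime j m) ω e) :
    Measurable[m'] (windowFactor G α ord clock M x i k p j m a) := by
  by_cases h : m ∈ Finset.Ico (2 ^ (k a + j)) (2 ^ (k a + 1 + j))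
  · have : windowFactor G α ord clock M x i k p j m a =
        cellFactor G α ord clock (M (gridTime j m)) p (gridTime j m) (gridTime j (m + 1))
          (x a) (i a) := by funext ω; rw [windowFactor, if_pos h]
    rw [this]
    exact measurable_cellFactor hm hM p (i a)
  · have : windowFactor G α ord clock M x i k p j m a = fun _ => 1 := by
      funext ω; rw [windowFactor, if_neg h]
    rw [this]
    exact measurable_const

/-- Within one cell the clocks of different vertices act independently given the past. -/
lemma lintegral_mul_prod_windowFactor_le (h : IsClockFamily P clock) (hp : 0 ≤ p)
    (hM : ∀ t e, Measurable[clockHistory clock t] fun ω => M t ω e) (m : ℕ) {J : Finset ι}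
    (hx : Set.InjOn x J) {F : Ω → ℝ≥0∞}
    (hF : Measurable[clockSigma clock (x '' J)ᶜ ⊔ clockHistory clock (gridTime j m)] F) :
    ∫⁻ ω, F ω * ∏ a ∈ J, windowFactor G α ord clock M x i k p j m a ω ∂P ≤
      (∏ a ∈ J, windowMean k p j m a) * ∫⁻ ω, F ω ∂P := by
  suffices H : ∀ J' ⊆ J,
      ∫⁻ ω, F ω * ∏ a ∈ J', windowFactor G α ord clock M x i k p j m a ω ∂P ≤
        (∏ a ∈ J', windowMean k p j m a) * ∫⁻ ω, F ω ∂P from H J subset_rfl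
  intro J'
  induction J' using Finset.induction_on with
  | empty => simp
  | insert a J' ha ih =>
    intro hsub
    have haJ : a ∈ J := hsub (Finset.mem_insert_self _ _)
    have hJ' : J' ⊆ J := (Finset.subset_insert _ _).trans hsub
    simp_rw [Finset.prod_insert ha]
    have hF' : Measurable[restSigma clock (x a) (gridTime j m)]
        fun ω => F ω * ∏ b ∈ J', windowFactor G α ord clock M x i k p j m b ω := by
      refine Measurable.mul (hF.mono (sup_le ?_ (clockHistory_le_restSigma _ _)) le_rfl) ?_
      · refine (clockSigma_mono ?_).trans le_sup_right
        exact Set.compl_subset_compl.2 (Set.singleton_subset_iff.2 ⟨a, haJ, rfl⟩)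
      · refine Finset.measurable_fun_prod _ fun b hb => measurable_windowFactor ?_ ?_
        · have hne : x b ≠ x a := fun heq => ha (hx (hJ' hb) haJ heq ▸ hb)
          exact (pointSigma_mono (Set.subset_univ _)).trans
            ((le_iSup₂ (f := fun v (_ : v ∈ ({x a}ᶜ : Set V)) => pointSigma (clock v) Set.univ)
              (x b) hne).trans le_sup_right)
        · exact fun e => (hM _ e).mono (clockHistory_le_restSigma _ _) le_rfl
    by_cases hwin : m ∈ Finset.Ico (2 ^ (k a + j)) (2 ^ (k a + 1 + j))
    · have h1 := lintegral_mul_cellFactor_le (α := α) (ord := ord) (p := p) h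
        (gridTime_mono j (Nat.le_succ m)) ?_ hp (x a) (i a) (hM (gridTime j m)) hF'
      · simp only [windowFactor, windowMean, if_pos hwin] at h1 ih ⊢
        have h2 : ((gridTime j (m + 1) : ℝ≥0) : ℝ) - gridTime j m = (2 ^ j)⁻¹ := by
          rw [gridTime_succ]; push_cast; ring
        rw [Nat.succ_eq_add_one, h2] at h1
        refine le_trans (le_of_eq (lintegral_congr fun ω => ?_)) (h1.trans ?_)
        · ring
        · rw [mul_assoc]
          gcongr
          exact ih hJ'
      · rw [Nat.succ_eq_add_one, gridTime_succ]
        gcongr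
        exact inv_le_one_of_one_le₀ (one_le_pow₀ one_le_two)
    · simp only [windowFactor, windowMean, if_neg hwin, one_mul] at ih ⊢
      exact ih hJ'

/-- The joint exponential moment over the first `n` cells, restricted to an event `A` that does not
involve the clocks of the vertices `x a`. -/
lemma lintegral_prod_windowFactor_le (h : IsClockFamily P clock) (hp : 0 ≤ p)
    (hM : ∀ t e, Measurable[clockHistory clock t] fun ω => M t ω e) {J : Finset ι}
    (hx : Set.InjOn x J) {A : Set Ω} (hA : MeasurableSet[clockSigma clock (x '' J)ᶜ] A) (n : ℕ) :
    ∫⁻ ω, A.indicator 1 ω * ∏ m ∈ Finset.range n, ∏ a ∈ J,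
        windowFactor G α ord clock M x i k p j m a ω ∂P ≤
      (∏ m ∈ Finset.range n, ∏ a ∈ J, windowMean k p j m a) * P A := by
  induction n with
  | zero => simp [lintegral_indicator_one (h.clockSigma_le _ _ hA)]
  | succ n ih =>
    have hmeas : Measurable[clockSigma clock (x '' J)ᶜ ⊔ clockHistory clock (gridTime j n)]
        fun ω => A.indicator (1 : Ω → ℝ≥0∞) ω * ∏ m ∈ Finset.range n, ∏ a ∈ J,
          windowFactor G α ord clock M x i k p j m a ω := by
      refine Measurable.mul ?_ (Finset.measurable_fun_prod _ fun m hm =>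
        Finset.measurable_fun_prod _ fun a _ => measurable_windowFactor ?_ fun e => ?_)
      · exact Measurable.indicator measurable_const
          ((le_sup_left : _ ≤ clockSigma clock (x '' J)ᶜ ⊔ clockHistory clock (gridTime j n)) A hA)
      · refine (pointSigma_mono fun q hq => ?_).trans
          ((le_iSup (fun v => pointSigma (clock v) {q | q.1 ≤ gridTime j n}) (x a)).trans
            le_sup_right)
        exact le_trans hq (gridTime_mono j (Finset.mem_range.1 hm))
      · refine (hM _ e).mono (le_trans ?_ le_sup_right) le_rfl
        refine iSup_mono fun v => pointSigma_mono fun q hq => ?_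
        exact le_trans hq (gridTime_mono j (Finset.mem_range.1 hm).le)
    simp_rw [Finset.prod_range_succ, ← mul_assoc]
    refine (lintegral_mul_prod_windowFactor_le h hp hM n hx hmeas).trans ?_
    rw [mul_comm (∏ m ∈ Finset.range n, _) (∏ a ∈ J, _), mul_assoc]
    gcongr

omit [DecidableEq ι] in
lemma prod_windowMean_le (hp : 0 ≤ p) (hp1 : p ≤ 1) {n : ℕ} (a : ι)
    (hn : 2 ^ (k a + 1 + j) ≤ n) :
    ∏ m ∈ Finset.range n, windowMean k p j m a ≤
      ENNReal.ofReal (Real.exp (-(2 ^ k a * p / 4))) := by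
  have hsub : Finset.Ico (2 ^ (k a + j)) (2 ^ (k a + 1 + j)) ⊆ Finset.range n := fun m hm =>
    Finset.mem_range.2 ((Finset.mem_Ico.1 hm).2.trans_le hn)
  have hcard : (Finset.Ico (2 ^ (k a + j)) (2 ^ (k a + 1 + j))).card = 2 ^ (k a + j) := by
    rw [Nat.card_Ico, show k a + 1 + j = k a + j + 1 by ring, pow_succ]
    omega
  simp only [windowMean]
  rw [Finset.prod_ite_mem, Finset.inter_eq_right.2 hsub, Finset.prod_const, hcard,
    ← ENNReal.ofReal_pow]
  · refine ENNReal.ofReal_le_ofReal ?_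
    have h1 : 1 - (2 ^ j : ℝ)⁻¹ * p / 4 ≤ Real.exp (-((2 ^ j : ℝ)⁻¹ * p / 4)) := by
      linarith [Real.add_one_le_exp (-((2 ^ j : ℝ)⁻¹ * p / 4))]
    have h0 : 0 ≤ 1 - (2 ^ j : ℝ)⁻¹ * p / 4 := by
      have : (2 ^ j : ℝ)⁻¹ ≤ 1 := inv_le_one_of_one_le₀ (one_le_pow₀ one_le_two)
      nlinarith [mul_le_one₀ this hp hp1]
    refine (pow_le_pow_left₀ h0 h1 _).trans_eq ?_
    rw [← Real.exp_nat_mul]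
    congr 1
    push_cast
    rw [pow_add]
    field_simp
  · have : (2 ^ j : ℝ)⁻¹ ≤ 1 := inv_le_one_of_one_le₀ (one_le_pow₀ one_le_two)
    nlinarith [mul_le_one₀ this hp hp1]

end Joint

/-! ### Slow growth in a dyadic window -/

section Slow

variable {V Ω : Type*} [Countable V] [MeasurableSpace Ω] {P : Measure Ω} [IsProbabilityMeasure P]
  {clock : V → Ω → Set Atom}
  {G : SimpleGraph V} [G.LocallyFinite] {α : ℝ}
  {ord : ∀ v, Fin (G.degree v) ≃ G.neighborSet v} {N : ℝ≥0 → Ω → G.edgeSet → ℕ}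

instance countable_edgeSet : Countable G.edgeSet :=
  have : Countable (Sym2 V) := inferInstanceAs (Countable (Quot _))
  inferInstance

omit [Countable V] [IsProbabilityMeasure P] in
lemma IsClockFamily.ae_finite (h : IsClockFamily P clock) (v : V) (t : ℝ≥0) :
    ∀ᵐ ω ∂P, (clock v ω ∩ {p | p.1 ≤ t}).Finite := by
  have hB := measurableSet_upto t
  have h1 := congrArg (fun m => m {⊤}) ((h.poisson v).law_count _ hB (by simp [atomVolume_upto]))
  rw [Measure.map_apply ((h.poisson v).measurable_count _ hB) MeasurableSet.of_discrete,
    Measure.map_apply (measurable_of_countable _) MeasurableSet.of_discrete] at h1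
  have e2 : (Nat.cast : ℕ → ℕ∞) ⁻¹' {⊤} = ∅ := by
    ext n; simp
  rw [e2, measure_empty] at h1
  rw [ae_iff]
  convert h1 using 2
  ext ω
  exact Set.encard_eq_top_iff.symm

omit [IsProbabilityMeasure P] in
lemma IsUrnNetwork.ae_isTrajectory (hN : IsUrnNetwork G P α ord clock N) :
    ∀ᵐ ω ∂P, IsTrajectory G α ord (fun v => clock v ω) (fun r => N r ω) := by
  have h2 : ∀ᵐ ω ∂P, ∀ v, ∀ T : ℕ, (clock v ω ∩ {p | p.1 ≤ (T : ℝ≥0)}).Finite :=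
    ae_all_iff.2 fun v => ae_all_iff.2 fun T => hN.clocks.ae_finite v T
  filter_upwards [hN.dynamics, h2] with ω h1 h2
  refine ⟨h1, fun v t => (h2 v ⌈t⌉₊).subset fun p hp => ⟨hp.1, ?_⟩⟩
  exact le_trans hp.2 (Nat.le_ceil t)

/-- In the window `[2 ^ k, 2 ^ (k + 1)]` the slot `i` of `x` always has selection probability at
least `p`, and yet its weight increases by at most `b`. -/
def SlowWindow (α : ℝ) (ord : ∀ v, Fin (G.degree v) ≃ G.neighborSet v)
    (n : ℝ≥0 → G.edgeSet → ℕ) (x : V) (i : Fin (G.degree x)) (k : ℕ) (p : ℝ) (b : ℕ) : Prop :=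
  (∀ s : ℝ≥0, 2 ^ k ≤ s → s < 2 ^ (k + 1) →
    p ≤ pol G α (fun e => (n s e : ℝ)) x (edgeTo G x (ord x i))) ∧
  n (2 ^ (k + 1)) (edgeTo G x (ord x i)) ≤ n (2 ^ k) (edgeTo G x (ord x i)) + b

variable {ι : Type*} [DecidableEq ι] {x : ι → V} {i : ∀ a, Fin (G.degree (x a))} {k : ι → ℕ} {p : ℝ}

omit [Countable V] [MeasurableSpace Ω] [DecidableEq ι] in
/-- On a fine grid, a slow window produces a product of cell factors that is not small. -/
lemma SlowWindow.eventually_one_le {ω : Ω} {M : ℝ≥0 → Ω → G.edgeSet → ℕ} {a : ι} {b : ℕ}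
    {n : ℕ → ℕ} (ht : IsTrajectory G α ord (fun v => clock v ω) (fun r => N r ω))
    (hM : ∀ j m e, M (gridTime j m) ω e = N (gridTime j m) ω e)
    (hs : SlowWindow α ord (fun r => N r ω) (x a) (i a) (k a) p b)
    (hn : ∀ j, 2 ^ (k a + 1 + j) ≤ n j) :
    ∀ᶠ j in atTop, 1 ≤ (2 : ℝ≥0∞) ^ b *
      ∏ m ∈ Finset.range (n j), windowFactor G α ord clock M x i k p j m a ω := by
  classical
  filter_upwards [ht.eventually_card_add_le (x a) (i a) (k a)] with j hj
  have hb := Nat.le_of_add_le_add_right ((hj.trans hs.2).trans_eq (add_comm _ _))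
  have hsub : Finset.Ico (2 ^ (k a + j)) (2 ^ (k a + 1 + j)) ⊆ Finset.range (n j) := fun m hm =>
    Finset.mem_range.2 ((Finset.mem_Ico.1 hm).2.trans_le (hn j))
  have hfac : ∀ m ∈ Finset.Ico (2 ^ (k a + j)) (2 ^ (k a + 1 + j)),
      cellFactor G α ord clock (M (gridTime j m)) p (gridTime j m) (gridTime j (m + 1))
        (x a) (i a) ω =
      if (clock (x a) ω ∩ hitBox G α ord (gridTime j m) (gridTime j (m + 1))
        (N (gridTime j m) ω) (x a) (i a)).Nonempty then 2⁻¹ else 1 := by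
    intro m hm
    have h1 : M (gridTime j m) ω = N (gridTime j m) ω := funext fun e => hM j m e
    have h2 : p ≤ pol G α (fun e => (N (gridTime j m) ω e : ℝ)) (x a)
        (edgeTo G (x a) (ord (x a) (i a))) := by
      refine hs.1 _ ?_ ?_
      · rw [← gridTime_pow j]
        exact gridTime_mono j (Finset.mem_Ico.1 hm).1
      · rw [← gridTime_pow j]
        have h3 := gridTime_mono j (Nat.succ_le_of_lt (Finset.mem_Ico.1 hm).2)
        refine lt_of_lt_of_le ?_ h3
        rw [Nat.succ_eq_add_one, gridTime_succ]
        exact lt_add_of_pos_right _ (by positivity)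
    rw [cellFactor, h1, if_pos h2, hitFactor]
  simp only [windowFactor]
  rw [Finset.prod_ite_mem, Finset.inter_eq_right.2 hsub, Finset.prod_congr rfl hfac,
    Finset.prod_ite, Finset.prod_const, Finset.prod_const_one, mul_one]
  refine le_trans ?_ (mul_le_mul_right
    (pow_le_pow_right_of_le_one' (by simp : (2 : ℝ≥0∞)⁻¹ ≤ 1) hb) _)
  rw [← mul_pow, ENNReal.mul_inv_cancel (by norm_num) (by norm_num), one_pow]

/-- Slow windows at distinct vertices are jointly as unlikely as if they were independent, also
given the other clocks. -/
lemma IsUrnNetwork.measure_slowWindow_le (hN : IsUrnNetwork G P α ord clock N)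
    (hp : 0 ≤ p) (hp1 : p ≤ 1) {J : Finset ι} (hx : Set.InjOn x J) (b : ι → ℕ)
    {A : Set Ω} (hA : MeasurableSet[clockSigma clock (x '' J)ᶜ] A) :
    P (A ∩ {ω | ∀ a ∈ J, SlowWindow α ord (fun r => N r ω) (x a) (i a) (k a) p (b a)}) ≤
      (∏ a ∈ J, 2 ^ b a * ENNReal.ofReal (Real.exp (-(2 ^ k a * p / 4)))) * P A := by
  let M : ℝ≥0 → Ω → G.edgeSet → ℕ := fun t ω e => (hN.adapted t e).mk _ ω
  have hM : ∀ t e, Measurable[clockHistory clock t] fun ω => M t ω e :=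
    fun t e => (hN.adapted t e).stronglyMeasurable_mk.measurable
  have hMN : ∀ᵐ ω ∂P, ∀ j m e, M (gridTime j m) ω e = N (gridTime j m) ω e :=
    ae_all_iff.2 fun j => ae_all_iff.2 fun m => ae_all_iff.2 fun e =>
      (hN.adapted _ e).ae_eq_mk.symm
  let n : ℕ → ℕ := fun j => J.sup fun a => 2 ^ (k a + 1 + j)
  have hn : ∀ j, ∀ a ∈ J, 2 ^ (k a + 1 + j) ≤ n j := fun j a ha =>
    Finset.le_sup (f := fun a => 2 ^ (k a + 1 + j)) ha
  let g : ℕ → Ω → ℝ≥0∞ := fun j ω => (∏ a ∈ J, 2 ^ b a) *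
    (A.indicator 1 ω * ∏ m ∈ Finset.range (n j), ∏ a ∈ J,
      windowFactor G α ord clock M x i k p j m a ω)
  have hgm : ∀ j, Measurable (g j) := by
    intro j
    refine Measurable.const_mul (Measurable.mul ?_ (Finset.measurable_fun_prod _ fun m _ =>
        Finset.measurable_fun_prod _ fun a _ => measurable_windowFactor ?_ fun e => ?_)) _
    · exact measurable_one.indicator (hN.clocks.clockSigma_le _ A hA)
    · exact (hN.clocks.poisson _).pointSigma_le _
    · exact (hM _ e).mono (hN.clocks.clockHistory_le _) le_rfl
  have hbound : ∀ j, ∫⁻ ω, g j ω ∂P ≤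
      (∏ a ∈ J, 2 ^ b a * ENNReal.ofReal (Real.exp (-(2 ^ k a * p / 4)))) * P A := by
    intro j
    have h1 := lintegral_prod_windowFactor_le (α := α) (ord := ord) (i := i) (k := k) (j := j)
      hN.clocks hp hM hx hA (n j)
    rw [lintegral_const_mul' _ _ (ENNReal.prod_ne_top fun a _ => by simp)]
    rw [Finset.prod_mul_distrib, mul_assoc]
    refine mul_le_mul_right (h1.trans ?_) _
    rw [Finset.prod_comm]
    gcongr with a ha
    exact prod_windowMean_le hp hp1 a (hn j a ha)
  have hpath : ∀ᵐ ω ∂P,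
      ω ∈ A ∩ {ω | ∀ a ∈ J, SlowWindow α ord (fun r => N r ω) (x a) (i a) (k a) p (b a)} →
      ω ∈ {ω | 1 ≤ liminf (fun j => g j ω) atTop} := by
    filter_upwards [hN.ae_isTrajectory, hMN] with ω ht hMω hω
    have hall : ∀ᶠ j in atTop, ∀ a ∈ J, 1 ≤ (2 : ℝ≥0∞) ^ b a *
        ∏ m ∈ Finset.range (n j), windowFactor G α ord clock M x i k p j m a ω :=
      (eventually_all_finset J).2 fun a ha =>
        (hω.2 a ha).eventually_one_le ht hMω fun j => hn j a ha
    refine le_liminf_of_le (by isBoundedDefault) (hall.mono fun j hj => ?_)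
    change 1 ≤ (∏ a ∈ J, (2 : ℝ≥0∞) ^ b a) * _
    rw [Set.indicator_of_mem hω.1, Pi.one_apply, one_mul, Finset.prod_comm,
      ← Finset.prod_mul_distrib]
    exact Finset.one_le_prod' hj
  calc P (A ∩ {ω | ∀ a ∈ J, SlowWindow α ord (fun r => N r ω) (x a) (i a) (k a) p (b a)})
      ≤ P {ω | 1 ≤ liminf (fun j => g j ω) atTop} := measure_mono_ae hpath
    _ ≤ ∫⁻ ω, liminf (fun j => g j ω) atTop ∂P := by
        simpa using mul_meas_ge_le_lintegral (μ := P) (Measurable.liminf hgm) 1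
    _ ≤ liminf (fun j => ∫⁻ ω, g j ω ∂P) atTop := lintegral_liminf_le hgm
    _ ≤ _ := (liminf_le_liminf (Eventually.of_forall hbound)).trans_eq (liminf_const _)

end Slow

/-! ### Joint bounds for low rates -/

/-- If the joint probabilities of events `E a (k a)` are bounded by products, so are those of the
unions `⋃ l, E a l`. -/
lemma measure_forall_exists_le {Ω ι κ : Type*} [Countable κ] [Nonempty κ] [MeasurableSpace Ω]
    {P : Measure Ω} [DecidableEq ι] (E : ι → κ → Set Ω) (c : ι → κ → ℝ≥0∞) (J : Finset ι) (A : Set Ω) (D : ℝ≥0∞)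
    (h : ∀ k : ι → κ, P (A ∩ {ω | ∀ a ∈ J, ω ∈ E a (k a)}) ≤ (∏ a ∈ J, c a (k a)) * D) :
    P (A ∩ {ω | ∀ a ∈ J, ∃ l, ω ∈ E a l}) ≤ (∏ a ∈ J, ∑' l, c a l) * D := by
  induction J using Finset.induction_on generalizing A D with
  | empty =>
    simpa using h fun _ => Classical.arbitrary κ
  | insert a J ha ih =>
    have hsub : A ∩ {ω | ∀ b ∈ insert a J, ∃ l, ω ∈ E b l} ⊆
        ⋃ l, (A ∩ E a l) ∩ {ω | ∀ b ∈ J, ∃ l, ω ∈ E b l} := by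
      rintro ω ⟨hA, hω⟩
      obtain ⟨l, hl⟩ := hω a (Finset.mem_insert_self _ _)
      exact Set.mem_iUnion.2 ⟨l, ⟨hA, hl⟩, fun b hb => hω b (Finset.mem_insert_of_mem hb)⟩
    refine (measure_mono hsub).trans ((measure_iUnion_le _).trans ?_)
    have hl : ∀ l, P ((A ∩ E a l) ∩ {ω | ∀ b ∈ J, ∃ l, ω ∈ E b l}) ≤
        (∏ b ∈ J, ∑' l, c b l) * (c a l * D) := by
      intro l
      refine ih (A ∩ E a l) (c a l * D) fun k => ?_
      have := h (Function.update k a l)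
      rw [Finset.prod_insert ha, Function.update_self] at this
      have hcongr : ∀ b ∈ J, Function.update k a l b = k b := fun b hb =>
        Function.update_of_ne (ne_of_mem_of_not_mem hb ha) _ _
      rw [Finset.prod_congr rfl fun b hb => by rw [hcongr b hb]] at this
      refine le_trans (measure_mono ?_) (this.trans_eq (by ring))
      rintro ω ⟨⟨hA, hE⟩, hω⟩
      refine ⟨hA, fun b hb => ?_⟩
      rcases Finset.mem_insert.1 hb with rfl | hb
      · rwa [Function.update_self]
      · rw [hcongr b hb]
        exact hω b hb
    refine (ENNReal.tsum_le_tsum hl).trans_eq ?_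
    rw [ENNReal.tsum_mul_left, ENNReal.tsum_mul_right, Finset.prod_insert ha]
    ring

section Nbhd

variable {V : Type*} {G : SimpleGraph V}

/-- The vertex `x` together with its neighbours. -/
def closedNbhd (G : SimpleGraph V) (x : V) : Set V := {v | v = x ∨ G.Adj x v}

lemma finite_closedNbhd [G.LocallyFinite] (x : V) : (closedNbhd G x).Finite :=
  ((Set.toFinite (G.neighborSet x)).insert x).subset fun _ hv => hv

lemma ncard_closedNbhd_le [G.LocallyFinite] (x : V) :
    (closedNbhd G x).ncard ≤ G.degree x + 1 := by
  have : closedNbhd G x = insert x (G.neighborSet x) := rfl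
  rw [this]
  refine (Set.ncard_insert_le _ _).trans ?_
  rw [Set.ncard_eq_toFinset_card', ← G.card_neighborSet_eq_degree, Set.toFinset_card]

end Nbhd

section Crowded

variable {V Ω : Type*} [MeasurableSpace Ω] {P : Measure Ω} {clock : V → Ω → Set Atom}
  {G : SimpleGraph V} [G.LocallyFinite]

/-- Some clock in the closed neighbourhood of `x` has, at some dyadic time after `2 ^ k₀`, rung
more than four times as often as expected. -/
def Crowded (G : SimpleGraph V) (clock : V → Ω → Set Atom) (k₀ : ℕ) (x : V) : Set Ω :=
  ⋃ v ∈ closedNbhd G x, ⋃ l : ℕ,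
    {ω | ((4 * 2 ^ (k₀ + l + 1) : ℕ) : ℕ∞) < (clock v ω ∩ {p | p.1 ≤ 2 ^ (k₀ + l + 1)}).encard}

omit [MeasurableSpace Ω] in
lemma measurableSet_crowded (k₀ : ℕ) (x : V) :
    MeasurableSet[clockSigma clock (closedNbhd G x)] (Crowded G clock k₀ x) := by
  refine MeasurableSet.biUnion (finite_closedNbhd x).countable fun v hv =>
    MeasurableSet.iUnion fun l => ?_
  have h1 : Measurable[pointSigma (clock v) Set.univ]
      fun ω => (clock v ω ∩ {p | p.1 ≤ 2 ^ (k₀ + l + 1)}).encard :=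
    measurable_count_pointSigma (measurableSet_upto _) (Set.subset_univ _)
  have h2 := h1.mono (le_iSup₂ (f := fun v (_ : v ∈ closedNbhd G x) =>
    pointSigma (clock v) Set.univ) v hv) le_rfl
  exact h2 (MeasurableSet.of_discrete (s := {c | ((4 * 2 ^ (k₀ + l + 1) : ℕ) : ℕ∞) < c}))

lemma IsClockFamily.measure_crowded_le (h : IsClockFamily P clock) {Δ : ℕ}
    (hΔ : ∀ v, G.degree v ≤ Δ) (k₀ : ℕ) (x : V) :
    P (Crowded G clock k₀ x) ≤ (Δ + 1 : ℕ) * 2⁻¹ ^ k₀ := by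
  have hv : ∀ v, P (⋃ l : ℕ, {ω | ((4 * 2 ^ (k₀ + l + 1) : ℕ) : ℕ∞) <
      (clock v ω ∩ {p | p.1 ≤ 2 ^ (k₀ + l + 1)}).encard}) ≤ 2⁻¹ ^ k₀ := by
    intro v
    have hl : ∀ l : ℕ, P {ω | ((4 * 2 ^ (k₀ + l + 1) : ℕ) : ℕ∞) <
        (clock v ω ∩ {p | p.1 ≤ 2 ^ (k₀ + l + 1)}).encard} ≤ 2⁻¹ ^ (k₀ + 1) * 2⁻¹ ^ l := by
      intro l
      refine ((h.poisson v).measure_lt_count (measurableSet_upto _)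
        (by rw [atomVolume_upto]; simp)).trans ?_
      rw [← pow_add]
      refine (pow_le_pow_left' (ENNReal.inv_le_inv.2 (by norm_num : (2 : ℝ≥0∞) ≤ 4)) _).trans ?_
      refine pow_le_pow_right_of_le_one' (by simp) ?_
      have := (Nat.lt_two_pow_self (n := k₀ + l + 1)).le
      omega
    refine (measure_iUnion_le _).trans ((ENNReal.tsum_le_tsum hl).trans_eq ?_)
    rw [ENNReal.tsum_mul_left, ENNReal.tsum_geometric, ENNReal.one_sub_inv_two, inv_inv, pow_succ,
      mul_assoc, ENNReal.inv_mul_cancel (by norm_num) (by norm_num), mul_one]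
  have hfin := finite_closedNbhd (G := G) x
  have : Crowded G clock k₀ x = ⋃ v ∈ hfin.toFinset, ⋃ l : ℕ,
      {ω | ((4 * 2 ^ (k₀ + l + 1) : ℕ) : ℕ∞) <
        (clock v ω ∩ {p | p.1 ≤ 2 ^ (k₀ + l + 1)}).encard} := by
    simp only [Crowded, Set.Finite.mem_toFinset]
  rw [this]
  refine (measure_biUnion_finset_le _ _).trans ((Finset.sum_le_card_nsmul _ _ _
    fun v _ => hv v).trans ?_)
  rw [nsmul_eq_mul, ← Set.ncard_eq_toFinset_card _ hfin]
  gcongr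
  exact (ncard_closedNbhd_le x).trans (Nat.succ_le_succ (hΔ x))

/-- The crowded events at points with disjoint closed neighbourhoods are independent, also of the
clocks outside of these neighbourhoods. -/
lemma IsClockFamily.measure_inter_crowded_le [IsProbabilityMeasure P] (h : IsClockFamily P clock)
    {Δ : ℕ} (hΔ : ∀ v, G.degree v ≤ Δ) (k₀ : ℕ) {ι : Type*} [DecidableEq ι] {x : ι → V}
    {A : Set Ω} {W : Set V}
    (hA : MeasurableSet[clockSigma clock W] A) (K : Finset ι)
    (hW : ∀ a ∈ K, Disjoint W (closedNbhd G (x a)))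
    (hK : (K : Set ι).PairwiseDisjoint fun a => closedNbhd G (x a)) :
    MeasurableSet[clockSigma clock (W ∪ ⋃ a ∈ K, closedNbhd G (x a))]
      (A ∩ {ω | ∀ a ∈ K, ω ∈ Crowded G clock k₀ (x a)}) ∧
    P (A ∩ {ω | ∀ a ∈ K, ω ∈ Crowded G clock k₀ (x a)}) ≤
      (∏ _a ∈ K, ((Δ + 1 : ℕ) * 2⁻¹ ^ k₀ : ℝ≥0∞)) * P A := by
  induction K using Finset.induction_on with
  | empty => exact ⟨clockSigma_mono Set.subset_union_left _ (by simpa using hA), by simp⟩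
  | insert a K ha ih =>
    obtain ⟨ih1, ih2⟩ := ih (fun b hb => hW b (Finset.mem_insert_of_mem hb))
      (hK.subset (Finset.coe_subset.2 (Finset.subset_insert _ _)))
    have hset : A ∩ {ω | ∀ b ∈ insert a K, ω ∈ Crowded G clock k₀ (x b)} =
        (A ∩ {ω | ∀ b ∈ K, ω ∈ Crowded G clock k₀ (x b)}) ∩ Crowded G clock k₀ (x a) := by
      ext ω
      simp only [Set.mem_inter_iff, Set.mem_ofPred_eq, Finset.forall_mem_insert]
      tauto
    have hdisj : Disjoint (W ∪ ⋃ b ∈ K, closedNbhd G (x b)) (closedNbhd G (x a)) := by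
      refine Set.disjoint_union_left.2 ⟨hW a (Finset.mem_insert_self _ _), ?_⟩
      refine Set.disjoint_iUnion₂_left.2 fun b hb => ?_
      exact hK (Finset.mem_coe.2 (Finset.mem_insert_of_mem hb))
        (Finset.mem_coe.2 (Finset.mem_insert_self _ _)) (fun hba => ha (hba ▸ hb))
    rw [hset]
    constructor
    · refine MeasurableSet.inter (clockSigma_mono ?_ _ ih1)
        (clockSigma_mono ?_ _ (measurableSet_crowded k₀ (x a)))
      · refine Set.union_subset_union_right _ (Set.biUnion_subset_biUnion_left ?_)
        exact fun b hb => Finset.mem_insert_of_mem hb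
      · exact (Set.subset_biUnion_of_mem (u := fun b => closedNbhd G (x b))
          (Finset.mem_coe.2 (Finset.mem_insert_self a K))).trans Set.subset_union_right
    · rw [(Indep_iff _ _ _).1 (h.indep_clockSigma hdisj) _ _ ih1 (measurableSet_crowded k₀ (x a)),
        Finset.prod_insert ha, mul_comm (P _), mul_assoc]
      exact mul_le_mul' (h.measure_crowded_le hΔ k₀ _) ih2

end Crowded

section LowRate

variable {V Ω : Type*} [Countable V] [MeasurableSpace Ω] {P : Measure Ω} [IsProbabilityMeasure P]
  {clock : V → Ω → Set Atom} {G : SimpleGraph V} [G.LocallyFinite] {α : ℝ}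
  {ord : ∀ v, Fin (G.degree v) ≃ G.neighborSet v} {N : ℝ≥0 → Ω → G.edgeSet → ℕ} {Δ : ℕ}

/-- The lower bound for the selection probability, in the window `[2 ^ k, 2 ^ (k + 1)]`, of a slot
whose weight is at least `2 ^ (k - k₀)`, when the clocks nearby are not crowded: all the weights at
the vertex are then at most `2 ^ (k + 5)`. -/
noncomputable def selectionBound (α : ℝ) (Δ k₀ : ℕ) : ℝ := ((2 ^ (k₀ + 5))⁻¹ : ℝ) ^ α / Δ

lemma selectionBound_nonneg (α : ℝ) (Δ k₀ : ℕ) : 0 ≤ selectionBound α Δ k₀ := by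
  unfold selectionBound; positivity

lemma selectionBound_le_one (hα : 0 ≤ α) (Δ k₀ : ℕ) : selectionBound α Δ k₀ ≤ 1 := by
  have h1 : ((2 ^ (k₀ + 5))⁻¹ : ℝ) ^ α ≤ 1 :=
    Real.rpow_le_one (by positivity) (inv_le_one_of_one_le₀ (one_le_pow₀ one_le_two)) hα
  unfold selectionBound
  rcases Nat.eq_zero_or_pos Δ with h | h
  · simp [h]
  · rw [div_le_one (by positivity)]
    exact h1.trans (by exact_mod_cast h)

omit [Countable V] [MeasurableSpace Ω] in
/-- Away from crowded clocks and slow windows, the rate is bounded below: the weight at the dyadic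
time `2 ^ (k₀ + l)` is at least `2 ^ l` for all `l`. -/
lemma le_lowerRate (hα : 0 ≤ α) (hΔ : ∀ v, G.degree v ≤ Δ) {ω : Ω} {k₀ : ℕ} {x : V}
    {i : Fin (G.degree x)}
    (ht : IsTrajectory G α ord (fun v => clock v ω) (fun r => N r ω))
    (hc : ω ∉ Crowded G clock k₀ x)
    (hs : ∀ l, ¬ SlowWindow α ord (fun r => N r ω) x i (k₀ + l) (selectionBound α Δ k₀) (2 ^ l)) :
    ((2 ^ (k₀ + 1))⁻¹ : ℝ≥0∞) ≤ lowerRate N ω (edgeTo G x (ord x i)) := by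
  set e := edgeTo G x (ord x i) with he
  have hcount : ∀ l, ∀ v ∈ closedNbhd G x,
      (clock v ω ∩ {p | p.1 ≤ 2 ^ (k₀ + l + 1)}).encard ≤ ((4 * 2 ^ (k₀ + l + 1) : ℕ) : ℕ∞) := by
    intro l v hv
    by_contra hlt
    exact hc (Set.mem_biUnion hv (Set.mem_iUnion.2 ⟨l, not_le.1 hlt⟩))
  have hgrow : ∀ l, 2 ^ l ≤ N (2 ^ (k₀ + l)) ω e := by
    intro l
    induction l with
    | zero => exact ht.one_le _ _
    | succ l ih =>
      by_contra hlt
      refine hs l ⟨fun s hs1 hs2 => ?_, ?_⟩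
      · refine le_pol (K := 2 ^ (k₀ + l + 5)) hα hΔ (by positivity) (by positivity) (ord x i)
          (fun z => ?_) (fun z => ht.one_le _ _) ?_
        · have h1 : N s ω (edgeTo G x z) ≤ 1 + 2 * (4 * 2 ^ (k₀ + l + 1)) :=
            (ht.mono hs2.le _).trans (ht.le_of_counts x z (hcount l x (Or.inl rfl))
              (hcount l z (Or.inr z.2)))
          have h2 : 1 + 2 * (4 * 2 ^ (k₀ + l + 1)) ≤ 2 ^ (k₀ + l + 5) := by
            have := Nat.one_le_two_pow (n := k₀ + l)
            have e1 : 2 ^ (k₀ + l + 1) = 2 * 2 ^ (k₀ + l) := by ring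
            have e2 : 2 ^ (k₀ + l + 5) = 32 * 2 ^ (k₀ + l) := by ring
            omega
          exact_mod_cast h1.trans h2
        · have h1 : 2 ^ l ≤ N s ω e := ih.trans (ht.mono hs1 e)
          have h2 : ((2 ^ (k₀ + 5))⁻¹ : ℝ) * 2 ^ (k₀ + l + 5) = 2 ^ l := by
            rw [show k₀ + l + 5 = (k₀ + 5) + l by ring, pow_add _ (k₀ + 5) l, ← mul_assoc,
              inv_mul_cancel₀ (by positivity), one_mul]
          rw [h2]
          exact_mod_cast h1
      · have h1 : N (2 ^ (k₀ + (l + 1))) ω e < 2 ^ (l + 1) := not_le.1 hlt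
        rw [pow_succ, mul_two] at h1
        exact (h1.le.trans (Nat.add_le_add_right ih _))
  refine le_liminf_of_le (by isBoundedDefault) ?_
  filter_upwards [eventually_ge_atTop ((2 : ℝ≥0) ^ k₀)] with t ht0
  obtain ⟨m, hm1, hm2⟩ := exists_nat_pow_near
    (show 1 ≤ t from (one_le_pow₀ one_le_two).trans ht0) one_lt_two
  have hkm : k₀ ≤ m := by
    have := ht0.trans_lt hm2
    exact Nat.lt_succ_iff.1 ((pow_lt_pow_iff_right₀ one_lt_two).1 this)
  obtain ⟨l, rfl⟩ := Nat.exists_eq_add_of_le hkm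
  have h1 : 2 ^ l ≤ N t ω e := (hgrow l).trans (ht.mono hm1 e)
  have htpos : 0 < t := lt_of_lt_of_le (by positivity) ht0
  rw [rate, ENNReal.le_div_iff_mul_le (Or.inl (by exact_mod_cast htpos.ne')) (Or.inl (by simp))]
  have h2 : (t : ℝ≥0∞) ≤ 2 ^ (k₀ + 1) * 2 ^ l := by
    rw [← pow_add, show k₀ + 1 + l = k₀ + l + 1 by ring]
    exact_mod_cast hm2.le
  calc (2 ^ (k₀ + 1) : ℝ≥0∞)⁻¹ * t ≤ (2 ^ (k₀ + 1))⁻¹ * (2 ^ (k₀ + 1) * 2 ^ l) := by gcongr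
    _ = 2 ^ l := by
        rw [← mul_assoc, ENNReal.inv_mul_cancel (by simp) (by simp), one_mul]
    _ ≤ N t ω e := by exact_mod_cast h1

/-- The bound for the probability of a slow window that starts at time `2 ^ k₀`; for a window that
starts at time `2 ^ (k₀ + l)` the bound is the power of this with exponent `2 ^ l`. -/
noncomputable def slowBound (α : ℝ) (Δ k₀ : ℕ) : ℝ≥0∞ :=
  2 * ENNReal.ofReal (Real.exp (-(2 ^ k₀ * selectionBound α Δ k₀ / 4)))

/-- The bound for the probability that an edge has rate below `2 ^ (-(k₀ + 1))`. -/
noncomputable def lowRateBound (α : ℝ) (Δ k₀ : ℕ) : ℝ≥0∞ :=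
  (Δ + 1 : ℕ) * 2⁻¹ ^ k₀ + ∑' l : ℕ, slowBound α Δ k₀ ^ 2 ^ l

/-- Edges with well-separated endpoints have low rates with at most the product of the individual
bounds, also given clocks that are far away. -/
lemma IsUrnNetwork.measure_lowerRate_lt_le (hN : IsUrnNetwork G P α ord clock N) (hα : 0 ≤ α)
    (hΔ : ∀ v, G.degree v ≤ Δ) (k₀ : ℕ) {ι : Type*} [DecidableEq ι] {x : ι → V}
    (i : ∀ a, Fin (G.degree (x a))) {A : Set Ω} {W : Set V}
    (hA : MeasurableSet[clockSigma clock W] A) (J : Finset ι)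
    (hW : ∀ a ∈ J, Disjoint W (closedNbhd G (x a)))
    (hJ : (J : Set ι).PairwiseDisjoint fun a => closedNbhd G (x a)) :
    P (A ∩ {ω | ∀ a ∈ J,
        lowerRate N ω (edgeTo G (x a) (ord (x a) (i a))) < (2 ^ (k₀ + 1))⁻¹}) ≤
      lowRateBound α Δ k₀ ^ J.card * P A := by
  set p := selectionBound α Δ k₀
  let E : ι → ℕ → Set Ω := fun a l =>
    {ω | SlowWindow α ord (fun r => N r ω) (x a) (i a) (k₀ + l) p (2 ^ l)}
  -- decompose according to the set `K` of those indices at which the clocks are crowded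
  have hcover : P (A ∩ {ω | ∀ a ∈ J,
      lowerRate N ω (edgeTo G (x a) (ord (x a) (i a))) < (2 ^ (k₀ + 1))⁻¹}) ≤
      P (⋃ K ∈ J.powerset, (A ∩ {ω | ∀ a ∈ K, ω ∈ Crowded G clock k₀ (x a)}) ∩
        {ω | ∀ a ∈ J \ K, ∃ l, ω ∈ E a l}) := by
    refine measure_mono_ae ?_
    filter_upwards [hN.ae_isTrajectory] with ω ht hω
    classical
    refine Set.mem_biUnion (x := J.filter fun a => ω ∈ Crowded G clock k₀ (x a))
      (Finset.mem_powerset.2 (Finset.filter_subset _ _)) ⟨⟨hω.1, fun a ha =>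
        (Finset.mem_filter.1 ha).2⟩, fun a ha => ?_⟩
    obtain ⟨haJ, haI⟩ := Finset.mem_sdiff.1 ha
    by_contra hno
    refine absurd (hω.2 a haJ) (not_lt.2 (le_lowerRate hα hΔ ht (fun hc => haI ?_) ?_))
    · exact Finset.mem_filter.2 ⟨haJ, hc⟩
    · exact fun l hl => hno ⟨l, hl⟩
  refine hcover.trans ((measure_biUnion_finset_le _ _).trans ?_)
  rw [lowRateBound, ← Finset.prod_const, Finset.prod_add, Finset.sum_mul]
  refine Finset.sum_le_sum fun K hK => ?_
  have hIJ := Finset.mem_powerset.1 hK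
  obtain ⟨h1, h2⟩ := hN.clocks.measure_inter_crowded_le hΔ k₀ hA K
    (fun a ha => hW a (hIJ ha)) (hJ.subset (Finset.coe_subset.2 hIJ))
  have hself : ∀ a, x a ∈ closedNbhd G (x a) := fun a => Or.inl rfl
  have hinj : Set.InjOn x (J \ K : Finset ι) := by
    intro a ha b hb hab
    by_contra hne
    have := hJ (Finset.mem_coe.2 (Finset.mem_sdiff.1 ha).1)
      (Finset.mem_coe.2 (Finset.mem_sdiff.1 hb).1) hne
    exact Set.disjoint_left.1 this (hself a) (hab ▸ hself b)
  have h1' : MeasurableSet[clockSigma clock (x '' (J \ K : Finset ι))ᶜ]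
      (A ∩ {ω | ∀ a ∈ K, ω ∈ Crowded G clock k₀ (x a)}) := by
    refine clockSigma_mono ?_ _ h1
    refine Set.subset_compl_iff_disjoint_right.2 (Set.disjoint_left.2 ?_)
    rintro _ hv ⟨a, ha, rfl⟩
    obtain ⟨haJ, haI⟩ := Finset.mem_sdiff.1 (Finset.mem_coe.1 ha)
    rcases hv with hv | hv
    · exact Set.disjoint_left.1 (hW a haJ) hv (hself a)
    · obtain ⟨b, hb, hv⟩ := Set.mem_iUnion₂.1 hv
      have := hJ (Finset.mem_coe.2 (hIJ hb)) (Finset.mem_coe.2 haJ) (fun hba => haI (hba ▸ hb))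
      exact Set.disjoint_left.1 this hv (hself a)
  have hslow := measure_forall_exists_le (P := P) E (fun _ l => slowBound α Δ k₀ ^ 2 ^ l) (J \ K)
    (A ∩ {ω | ∀ a ∈ K, ω ∈ Crowded G clock k₀ (x a)})
    (P (A ∩ {ω | ∀ a ∈ K, ω ∈ Crowded G clock k₀ (x a)})) fun k => by
      refine (hN.measure_slowWindow_le (k := fun a => k₀ + k a) (i := i)
        (selectionBound_nonneg α Δ k₀)
        (selectionBound_le_one hα Δ k₀) hinj (fun a => 2 ^ k a) h1').trans_eq ?_
      congr 1
      refine Finset.prod_congr rfl fun a _ => ?_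
      rw [slowBound, mul_pow, ← ENNReal.ofReal_pow (Real.exp_pos _).le, ← Real.exp_nat_mul]
      congr 3
      push_cast
      ring
  refine hslow.trans ?_
  rw [mul_comm (∏ a ∈ K, _), mul_assoc]
  gcongr

/-- The bound for low rates becomes arbitrarily small; this is where `α < 1` enters. -/
lemma exists_lowRateBound_le (α : ℝ) (hα₁ : α < 1) (Δ : ℕ) {ε : ℝ≥0∞} (hε : 0 < ε) :
    ∃ k₀, lowRateBound α (Δ + 1) k₀ ≤ ε := by
  have hε4 : 0 < min (ε / 4) 2⁻¹ := lt_min (ENNReal.div_pos hε.ne' (by norm_num)) (by simp)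
  have hε2 : 0 < ε / 2 := ENNReal.div_pos hε.ne' (by norm_num)
  have h1 : Tendsto (fun k : ℕ => ((Δ + 1 + 1 : ℕ) * 2⁻¹ ^ k : ℝ≥0∞)) atTop (nhds 0) := by
    have := ENNReal.Tendsto.const_mul (a := ((Δ + 1 + 1 : ℕ) : ℝ≥0∞))
      (ENNReal.tendsto_pow_atTop_nhds_zero_of_lt_one (ENNReal.inv_lt_one.2 ENNReal.one_lt_two))
      (Or.inr (ENNReal.natCast_ne_top _))
    simpa using this
  have h2 : Tendsto (fun k : ℕ => (2 : ℝ) ^ k * selectionBound α (Δ + 1) k / 4) atTop atTop := by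
    have hr : 1 < (2 : ℝ) ^ (1 - α) := Real.one_lt_rpow one_lt_two (by linarith)
    have h3 := (tendsto_pow_atTop_atTop_of_one_lt hr).const_mul_atTop
      (show 0 < ((2 : ℝ) ^ (5 : ℕ))⁻¹ ^ α / ((Δ + 1 : ℕ) * 4) by positivity)
    refine h3.congr fun k => ?_
    rw [selectionBound, pow_add, mul_inv, Real.mul_rpow (by positivity) (by positivity),
      Real.rpow_sub (by norm_num), Real.rpow_one, div_pow,
      Real.inv_rpow (x := 2 ^ k) (by positivity),
      ← Real.rpow_natCast (2 ^ α), ← Real.rpow_natCast 2 k, ← Real.rpow_mul (by norm_num),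
      ← Real.rpow_mul (by norm_num), mul_comm α]
    field_simp
  have h4 : Tendsto (fun k => slowBound α (Δ + 1) k) atTop (nhds 0) := by
    have h5 := ENNReal.tendsto_ofReal (Real.tendsto_exp_neg_atTop_nhds_zero.comp h2)
    rw [ENNReal.ofReal_zero] at h5
    have := ENNReal.Tendsto.const_mul (a := 2) h5 (Or.inr (by norm_num))
    simpa [slowBound] using this
  obtain ⟨k, hk1, hk2⟩ := ((h1.eventually_le_const hε2).and (h4.eventually_le_const hε4)).exists
  refine ⟨k, ?_⟩
  have hq1 : slowBound α (Δ + 1) k ≤ 2⁻¹ := hk2.trans (min_le_right _ _)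
  have hq2 : slowBound α (Δ + 1) k ≤ ε / 4 := hk2.trans (min_le_left _ _)
  set q := slowBound α (Δ + 1) k
  have hsum : ∑' l : ℕ, q ^ 2 ^ l ≤ ε / 2 := by
    calc ∑' l : ℕ, q ^ 2 ^ l ≤ ∑' l : ℕ, q * 2⁻¹ ^ l := by
          refine ENNReal.tsum_le_tsum fun l => ?_
          calc q ^ 2 ^ l ≤ q ^ (l + 1) :=
                pow_le_pow_right_of_le_one' (hq1.trans (by simp)) Nat.lt_two_pow_self
            _ = q * q ^ l := pow_succ' _ _
            _ ≤ q * 2⁻¹ ^ l := by gcongr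
      _ = q * 2 := by
          rw [ENNReal.tsum_mul_left, ENNReal.tsum_geometric, ENNReal.one_sub_inv_two, inv_inv]
      _ ≤ ε / 4 * 2 := by gcongr
      _ = ε / 2 := by
          rw [div_eq_mul_inv, div_eq_mul_inv, mul_assoc]
          congr 1
          rw [show (4 : ℝ≥0∞) = 2 * 2 by norm_num,
            ENNReal.mul_inv (Or.inl (by norm_num)) (Or.inl (by norm_num)), mul_assoc,
            ENNReal.inv_mul_cancel (by norm_num) (by norm_num), mul_one]
  calc lowRateBound α (Δ + 1) k ≤ ε / 2 + ε / 2 := add_le_add hk1 hsum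
    _ = ε := ENNReal.add_halves ε

end LowRate

/-! ### Conditional probabilities of positive rates -/

section Conditional

/-- A lower bound for the conditional probability of `s`, from upper bounds for the probability of
its complement on the conditioning events. -/
lemma le_condExp_indicator {Ω : Type*} {m mΩ : MeasurableSpace Ω} {P : Measure Ω}
    [IsProbabilityMeasure P] (hm : m ≤ mΩ) {s : Set Ω} (hs : NullMeasurableSet s P) {ε : ℝ≥0}
    (h : ∀ A, MeasurableSet[m] A → P (A ∩ sᶜ) ≤ ε * P A) :
    ∀ᵐ ω ∂P, 1 - (ε : ℝ) ≤ (P⟦s | m⟧) ω := by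
  have hint : Integrable (s.indicator fun _ => (1 : ℝ)) P :=
    (integrable_const 1).indicator₀ hs
  refine ae_le_of_ae_le_trim (hm := hm) ?_
  refine ae_le_of_forall_setIntegral_le (integrable_const _)
    (integrable_condExp.trim hm stronglyMeasurable_condExp) fun A hA _ => ?_
  rw [← setIntegral_trim hm stronglyMeasurable_condExp hA, setIntegral_condExp hm hint hA,
    setIntegral_const, smul_eq_mul, measureReal_def, trim_measurableSet_eq hm hA,
    ← integral_indicator (hm A hA), Set.indicator_indicator,
    integral_indicator₀ ((hm A hA).nullMeasurableSet.inter hs), setIntegral_const, smul_eq_mul,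
    mul_one, measureReal_def]
  have hsplit : P A = P (A ∩ s) + P (A ∩ sᶜ) :=
    (measure_inter_add_sdiff₀ A hs).symm
  have h1 := (ENNReal.toReal_le_toReal (measure_ne_top _ _)
    (ENNReal.mul_ne_top ENNReal.coe_ne_top (measure_ne_top _ _))).2 (h A hA)
  rw [ENNReal.toReal_mul, ENNReal.coe_toReal] at h1
  rw [hsplit, ENNReal.toReal_add (measure_ne_top _ _) (measure_ne_top _ _)] at h1 ⊢
  linarith

variable {V Ω : Type*} [MeasurableSpace Ω] {P : Measure Ω}
  {clock : V → Ω → Set Atom} {G : SimpleGraph V} [G.LocallyFinite] {α : ℝ}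
  {ord : ∀ v, Fin (G.degree v) ≃ G.neighborSet v} {N : ℝ≥0 → Ω → G.edgeSet → ℕ} {Δ : ℕ}

omit [MeasurableSpace Ω] [G.LocallyFinite] in
/-- By monotonicity of the weights, the lower rate is determined by integer times. -/
lemma lowerRate_eq_liminf_nat {ω : Ω} {e : G.edgeSet}
    (hmono : ∀ s t : ℝ≥0, s ≤ t → N s ω e ≤ N t ω e) :
    lowerRate N ω e = liminf (fun n : ℕ => (N n ω e : ℝ≥0∞) / n) atTop := by
  refine le_antisymm ?_ (le_of_forall_lt fun c hc => ?_)
  · have h := (tendsto_natCast_atTop_atTop (R := ℝ≥0)).liminf_le_liminf_comp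
      (u := fun t : ℝ≥0 => rate N t ω e) (by isBoundedDefault) (by isBoundedDefault)
    simpa [lowerRate, rate, Function.comp_def] using h
  · obtain ⟨c₁, hc1, hc1'⟩ := exists_between hc
    obtain ⟨c₂, hc2, hc2'⟩ := exists_between hc1'
    lift c₂ to ℝ≥0 using hc2'.ne_top
    lift c₁ to ℝ≥0 using hc2.ne_top
    refine hc1.trans_le (le_liminf_of_le (by isBoundedDefault) ?_)
    have hc21 : c₁ < c₂ := by exact_mod_cast hc2
    have hev := eventually_lt_of_lt_liminf hc2'
    obtain ⟨n₀, hn0⟩ := eventually_atTop.1 hev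
    obtain ⟨n₁, hn1⟩ := exists_nat_ge (c₁ / (c₂ - c₁))
    filter_upwards [eventually_ge_atTop ((n₀ + n₁ + 1 : ℕ) : ℝ≥0)] with t ht
    set n := ⌊t⌋₊ with hn
    have hnle : n₀ + n₁ + 1 ≤ n := Nat.le_floor ht
    have h1 := hn0 n (by omega)
    have hnpos : 0 < n := by omega
    have htpos : 0 < t := lt_of_lt_of_le (by positivity) ht
    have h2 : (c₂ : ℝ≥0∞) * n ≤ N n ω e :=
      (ENNReal.le_div_iff_mul_le (Or.inl (by exact_mod_cast hnpos.ne')) (Or.inl (by simp))).1 h1.le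
    have h3 : c₁ * (n + 1) ≤ c₂ * n := by
      rw [div_le_iff₀ (tsub_pos_of_lt hc21)] at hn1
      have h4 : (n₁ : ℝ≥0) * (c₂ - c₁) ≤ n * (c₂ - c₁) := by
        gcongr
        omega
      have h5 := add_le_add_left (hn1.trans h4) (n * c₁)
      rw [← mul_add, tsub_add_cancel_of_le hc21.le] at h5
      calc c₁ * (n + 1) = c₁ + n * c₁ := by ring
        _ ≤ n * c₂ := h5
        _ = c₂ * n := mul_comm _ _
    rw [rate, ENNReal.le_div_iff_mul_le (Or.inl (by exact_mod_cast htpos.ne')) (Or.inl (by simp))]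
    have h6 : c₁ * t ≤ c₂ * n := by
      refine le_trans ?_ h3
      gcongr
      exact (Nat.lt_floor_add_one t).le
    calc (c₁ : ℝ≥0∞) * t ≤ c₂ * n := by exact_mod_cast h6
      _ ≤ N n ω e := h2
      _ ≤ N t ω e := by exact_mod_cast hmono n t (Nat.floor_le t.2)

variable [Countable V]

/-- The lower rates are random variables; otherwise the conditional probabilities of the events
they define would be junk. -/
lemma IsUrnNetwork.aemeasurable_lowerRate (hN : IsUrnNetwork G P α ord clock N) (e : G.edgeSet) :
    AEMeasurable (fun ω => lowerRate N ω e) P := by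
  have h1 : ∀ n : ℕ, AEMeasurable (fun ω => (N n ω e : ℝ≥0∞) / n) P := by
    intro n
    have h2 : AEMeasurable (fun ω => N n ω e) P :=
      ((hN.adapted n e).mono (hN.clocks.clockHistory_le _)).aemeasurable
    exact (((measurable_of_countable (fun k : ℕ => (k : ℝ≥0∞))).comp_aemeasurable h2)).div_const _
  refine ⟨fun ω => liminf (fun n => (h1 n).mk _ ω) atTop,
    Measurable.liminf fun n => (h1 n).measurable_mk, ?_⟩
  filter_upwards [hN.ae_isTrajectory, ae_all_iff.2 fun n => (h1 n).ae_eq_mk] with ω ht h2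
  rw [lowerRate_eq_liminf_nat fun s t hst => ht.mono hst e]
  simp only [h2]

omit [MeasurableSpace Ω] [G.LocallyFinite] [Countable V] in
lemma disjoint_far_closedNbhd {e : G.edgeSet} {x : V} (hx : x ∈ e.1) :
    Disjoint {v : V | ∀ e' ∈ adjacentEdges e, v ∉ e'.1} (closedNbhd G x) := by
  refine Set.disjoint_left.2 fun v hv hv' => ?_
  rcases hv' with rfl | hadj
  · exact hv e ⟨v, hx, hx⟩ hx
  · exact hv ⟨s(x, v), hadj⟩ ⟨x, Sym2.mem_mk_left _ _, hx⟩ (Sym2.mem_mk_right _ _)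

omit [MeasurableSpace Ω] [Countable V] in
lemma exists_slot (ord : ∀ v, Fin (G.degree v) ≃ G.neighborSet v) (e : G.edgeSet) :
    ∃ x, ∃ i : Fin (G.degree x), edgeTo G x (ord x i) = e := by
  obtain ⟨e, he⟩ := e
  induction e using Sym2.ind with
  | _ x y => exact ⟨x, (ord x).symm ⟨y, he⟩, by simp [edgeTo]⟩

lemma IsUrnNetwork.exists_condProb_ge [IsProbabilityMeasure P]
    (hN : IsUrnNetwork G P α ord clock N) (hα₀ : 0 ≤ α) (hα₁ : α < 1)
    (hΔ : ∀ v, G.degree v ≤ Δ) {ε : ℝ} (hε : 0 < ε) :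
    ∃ δ : ℝ≥0, 0 < δ ∧ ∀ᵐ ω ∂P, ∀ e : G.edgeSet,
      1 - ε ≤ (P⟦{ω' | (δ : ℝ≥0∞) ≤ lowerRate N ω' e} | farSigma clock e⟧) ω := by
  lift ε to ℝ≥0 using hε.le
  have hε' : (0 : ℝ≥0∞) < ε := by exact_mod_cast hε
  obtain ⟨k₀, hk⟩ := exists_lowRateBound_le α hα₁ Δ hε'
  refine ⟨(2 ^ (k₀ + 1))⁻¹, by positivity, ae_all_iff.2 fun e => ?_⟩
  obtain ⟨x, i, rfl⟩ := exists_slot ord e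
  have hfar : farSigma clock (edgeTo G x (ord x i)) ≤
      clockSigma clock {v : V | ∀ e' ∈ adjacentEdges (edgeTo G x (ord x i)), v ∉ e'.1} :=
    iSup_le fun v => le_iSup₂ (f := fun v (_ : v ∈ {v : V | ∀ e' ∈ adjacentEdges
      (edgeTo G x (ord x i)), v ∉ e'.1}) => pointSigma (clock v) Set.univ) v.1 v.2
  have hcoe : (((2 ^ (k₀ + 1))⁻¹ : ℝ≥0) : ℝ≥0∞) = (2 ^ (k₀ + 1))⁻¹ := by
    rw [ENNReal.coe_inv (by positivity), ENNReal.coe_pow, ENNReal.coe_ofNat]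
  refine le_condExp_indicator (hfar.trans (hN.clocks.clockSigma_le _))
    ((hN.aemeasurable_lowerRate _).nullMeasurableSet_preimage measurableSet_Ici) fun A hA => ?_
  have h1 := hN.measure_lowerRate_lt_le hα₀ (fun v => (hΔ v).trans (Nat.le_succ Δ)) k₀
    (x := fun _ : Unit => x) (fun _ => i) (hfar A hA) {()}
    (fun _ _ => disjoint_far_closedNbhd (Sym2.mem_mk_left _ _)) (by simp)
  rw [Finset.card_singleton, pow_one] at h1
  refine le_trans (measure_mono ?_) (h1.trans (mul_le_mul_left hk _))
  rintro ω ⟨hωA, hω⟩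
  refine ⟨hωA, fun _ _ => ?_⟩
  rw [← hcoe]
  exact not_le.1 hω

lemma IsUrnNetwork.condProb_pos_eq_one [IsProbabilityMeasure P]
    (hN : IsUrnNetwork G P α ord clock N) (hα₀ : 0 ≤ α) (hα₁ : α < 1)
    (hΔ : ∀ v, G.degree v ≤ Δ) (e : G.edgeSet) :
    ∀ᵐ ω ∂P, (P⟦{ω' | 0 < lowerRate N ω' e} | farSigma clock e⟧) ω = 1 := by
  have hm : farSigma clock e ≤ ‹MeasurableSpace Ω› :=
    iSup_le fun v => (hN.clocks.poisson v.1).pointSigma_le _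
  have hpos : Integrable ({ω' | 0 < lowerRate N ω' e}.indicator fun _ => (1 : ℝ)) P :=
    (integrable_const 1).indicator₀
      ((hN.aemeasurable_lowerRate e).nullMeasurableSet_preimage measurableSet_Ioi)
  have hle : ∀ᵐ ω ∂P, (P⟦{ω' | 0 < lowerRate N ω' e} | farSigma clock e⟧) ω ≤ 1 := by
    have h1 := condExp_mono (m := farSigma clock e) hpos (integrable_const (1 : ℝ))
      (Eventually.of_forall (Set.indicator_le_self' fun _ _ => zero_le_one))
    rw [condExp_const hm] at h1
    exact h1
  have hge : ∀ n : ℕ, ∀ᵐ ω ∂P, 1 - 1 / ((n : ℝ) + 1) ≤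
      (P⟦{ω' | 0 < lowerRate N ω' e} | farSigma clock e⟧) ω := by
    intro n
    obtain ⟨δ, hδ, h1⟩ := hN.exists_condProb_ge hα₀ hα₁ hΔ (ε := 1 / ((n : ℝ) + 1)) (by positivity)
    have hint : Integrable ({ω' | (δ : ℝ≥0∞) ≤ lowerRate N ω' e}.indicator fun _ => (1 : ℝ)) P :=
      (integrable_const 1).indicator₀
        ((hN.aemeasurable_lowerRate e).nullMeasurableSet_preimage measurableSet_Ici)
    have h2 := condExp_mono (m := farSigma clock e) hint hpos
      (Eventually.of_forall (Set.indicator_le_indicator_of_subset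
        (fun ω (hω : (δ : ℝ≥0∞) ≤ lowerRate N ω e) =>
          (lt_of_lt_of_le (by exact_mod_cast hδ) hω : 0 < lowerRate N ω e)) fun _ => zero_le_one))
    filter_upwards [h1, h2] with ω h3 h4
    exact (h3 e).trans h4
  filter_upwards [hle, ae_all_iff.2 hge] with ω h1 h2
  refine le_antisymm h1 ?_
  have h3 : Tendsto (fun n : ℕ => 1 - 1 / ((n : ℝ) + 1)) atTop (nhds (1 - 0)) :=
    tendsto_const_nhds.sub tendsto_one_div_add_atTop_nhds_zero_nat
  rw [sub_zero] at h3
  exact le_of_tendsto' h3 h2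

end Conditional

/-! ### Chains of edges of low rate -/

section Graph

/-- The last exit from a set along a walk. -/
lemma exists_last_exit {E : Type*} {H : SimpleGraph E} (Q : E → Prop) {a b : E} (γ : H.Walk a b)
    (hb : ¬ Q b) : (∀ v ∈ γ.support, ¬ Q v) ∨
      ∃ u w, Q u ∧ H.Adj u w ∧ ∃ γ' : H.Walk w b, γ'.support ⊆ γ.support ∧
        ∀ v ∈ γ'.support, ¬ Q v := by
  induction γ with
  | nil => left; simpa using hb
  | @cons a w b h γ ih =>
    rcases ih hb with h1 | ⟨u, w', hu, huw, γ', hs, hQ⟩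
    · by_cases ha : Q a
      · exact Or.inr ⟨a, w, ha, h, γ, by simp, h1⟩
      · left
        intro v hv
        rw [SimpleGraph.Walk.support_cons, List.mem_cons] at hv
        rcases hv with rfl | hv
        · exact ha
        · exact h1 v hv
    · refine Or.inr ⟨u, w', hu, huw, γ', List.Subset.trans hs (by simp), hQ⟩

lemma edist_le_one_of_adj {E : Type*} {H : SimpleGraph E} {u v : E} (h : H.Adj u v) :
    H.edist u v ≤ 1 := by
  simpa using H.edist_le h.toWalk

/-- From a long walk one can extract a chain of points that are pairwise at distance at least `r`,
with consecutive distances at most `r`: each point is the first one after the last visit to the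
`r`-ball around its predecessor. -/
lemma exists_separated_chain {E : Type*} {H : SimpleGraph E} {r : ℕ} (hr : 0 < r) (n : ℕ) {a b : E}
    (γ : H.Walk a b) (hab : ((r * n : ℕ) : ℕ∞) < H.edist a b) :
    ∃ c : ℕ → E, c 0 = a ∧ (∀ m ≤ n, c m ∈ γ.support) ∧
      (∀ m < n, H.edist (c m) (c (m + 1)) ≤ r) ∧
      ∀ l m, l < m → m ≤ n → (r : ℕ∞) ≤ H.edist (c l) (c m) := by
  induction n generalizing a with
  | zero =>
    refine ⟨fun _ => a, rfl, fun _ _ => γ.start_mem_support, fun m hm => by omega,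
      fun l m h1 h2 => by omega⟩
  | succ n ih =>
    have hb : ¬ H.edist a b < r := by
      refine not_lt.2 (le_trans ?_ hab.le)
      exact_mod_cast Nat.le_mul_of_pos_right r (Nat.succ_pos n)
    rcases exists_last_exit (fun v => H.edist a v < r) γ hb with h1 | ⟨u, w, hu, huw, γ', hs, hQ⟩
    · refine absurd ?_ (h1 a γ.start_mem_support)
      rw [SimpleGraph.edist_self]
      exact_mod_cast hr
    · have haw : H.edist a w ≤ r := by
        refine (H.edist_triangle (v := u)).trans ?_
        refine le_trans (add_le_add le_rfl (edist_le_one_of_adj huw)) ?_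
        exact Order.add_one_le_of_lt hu
      have hwb : ((r * n : ℕ) : ℕ∞) < H.edist w b := by
        by_contra hle
        have h2 : H.edist a b ≤ r + (r * n : ℕ) :=
          (H.edist_triangle (v := w)).trans (add_le_add haw (not_lt.1 hle))
        refine absurd (hab.trans_le h2) (not_lt.2 (le_of_eq ?_))
        push_cast
        ring
      obtain ⟨c, hc0, hcs, hcd, hcsep⟩ := ih γ' hwb
      refine ⟨fun m => m.casesOn a c, rfl, ?_, ?_, ?_⟩
      · rintro (_ | m) hm
        · exact γ.start_mem_support
        · exact hs (hcs m (by omega))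
      · rintro (_ | m) hm
        · change H.edist a (c 0) ≤ r
          rw [hc0]
          exact haw
        · exact hcd m (by omega)
      · rintro (_ | l) (_ | m) h1 h2
        · omega
        · exact not_lt.1 (hQ _ (hcs m (by omega)))
        · omega
        · exact hcsep l m (by omega) (by omega)

variable {V : Type*} {G : SimpleGraph V}

lemma edist_lineGraph_le_one {e f : G.edgeSet} {v : V} (he : v ∈ e.1) (hf : v ∈ f.1) :
    G.lineGraph.edist e f ≤ 1 := by
  by_cases hef : e = f
  · rw [hef, SimpleGraph.edist_self]
    exact zero_le
  · refine edist_le_one_of_adj ?_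
    rw [SimpleGraph.lineGraph_adj_iff_exists]
    exact ⟨hef, v, he, hf⟩

lemma exists_edge_of_mem_closedNbhd {e : G.edgeSet} {x v : V} (hx : x ∈ e.1)
    (hv : v ∈ closedNbhd G x) : ∃ g : G.edgeSet, v ∈ g.1 ∧ G.lineGraph.edist e g ≤ 1 := by
  rcases hv with rfl | hadj
  · exact ⟨e, hx, edist_lineGraph_le_one hx hx⟩
  · exact ⟨⟨s(x, v), hadj⟩, Sym2.mem_mk_right _ _,
      edist_lineGraph_le_one hx (Sym2.mem_mk_left _ _)⟩

lemma disjoint_closedNbhd {e f : G.edgeSet} {x y : V} (hx : x ∈ e.1) (hy : y ∈ f.1)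
    (h : 4 ≤ G.lineGraph.edist e f) : Disjoint (closedNbhd G x) (closedNbhd G y) := by
  refine Set.disjoint_left.2 fun v hv hv' => ?_
  obtain ⟨g, hg, hg1⟩ := exists_edge_of_mem_closedNbhd hx hv
  obtain ⟨g', hg', hg1'⟩ := exists_edge_of_mem_closedNbhd hy hv'
  have h3 : G.lineGraph.edist e f ≤ 1 + (1 + 1) := by
    refine (G.lineGraph.edist_triangle (v := g)).trans (add_le_add hg1 ?_)
    refine (G.lineGraph.edist_triangle (v := g')).trans
      (add_le_add (edist_lineGraph_le_one hg hg') ?_)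
    rw [SimpleGraph.edist_comm]
    exact hg1'
  exact absurd (h.trans h3) (by decide)

/-- In a graph of bounded degree, the balls of a given radius in the line graph can be enumerated
by a common finite type. -/
lemma exists_ball_enumeration [G.LocallyFinite] {Δ : ℕ} (hΔ : ∀ v, G.degree v ≤ Δ)
    (ord : ∀ v, Fin (G.degree v) ≃ G.neighborSet v) (r : ℕ) :
    ∃ (T : Type) (_ : Fintype T) (φ : G.edgeSet → T → G.edgeSet),
      ∀ e f, G.lineGraph.edist e f ≤ r → ∃ t, φ e t = f := by
  induction r with
  | zero =>
    refine ⟨Unit, inferInstance, fun e _ => e, fun e f h => ⟨(), ?_⟩⟩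
    exact (SimpleGraph.edist_eq_zero_iff (G := G.lineGraph)).1
      (le_antisymm (by simpa using h) zero_le)
  | succ r ih =>
    obtain ⟨T, hT, φ, hφ⟩ := ih
    have hends : ∀ e : G.edgeSet, ∃ b : Bool → V, e.1 = s(b true, b false) := by
      rintro ⟨e, -⟩
      induction e using Sym2.ind with
      | _ x y => exact ⟨fun c => if c then x else y, by simp⟩
    choose b hb using hends
    let ψ : G.edgeSet → Option (Bool × Fin Δ) → G.edgeSet := fun e o => o.elim e fun q =>
      if h : q.2.1 < G.degree (b e q.1) then
        edgeTo G (b e q.1) (ord (b e q.1) ⟨q.2.1, h⟩) else e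
    have hψ : ∀ e f, G.lineGraph.Adj e f → ∃ t, ψ e t = f := by
      intro e f hadj
      obtain ⟨-, v, hve, hvf⟩ := SimpleGraph.lineGraph_adj_iff_exists.1 hadj
      obtain ⟨c, hc⟩ : ∃ c, b e c = v := by
        have hve' : v ∈ e.1 := hve
        rw [hb e] at hve'
        rcases Sym2.mem_iff.1 hve' with h | h
        · exact ⟨true, h.symm⟩
        · exact ⟨false, h.symm⟩
      obtain ⟨z, hz⟩ : ∃ z : G.neighborSet v, edgeTo G v z = f := by
        obtain ⟨f, hf⟩ := f
        have hvf' : v ∈ f := hvf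
        obtain ⟨y, rfl⟩ := Sym2.mem_iff_exists.1 hvf'
        exact ⟨⟨y, hf⟩, rfl⟩
      subst hc
      have hlt := ((ord (b e c)).symm z).2
      refine ⟨some (c, ⟨((ord (b e c)).symm z).1, hlt.trans_le (hΔ _)⟩), ?_⟩
      change (if h : _ then _ else _) = _
      rw [dif_pos hlt]
      simpa using hz
    refine ⟨T × Option (Bool × Fin Δ), inferInstance, fun e t => ψ (φ e t.1) t.2, fun e f h => ?_⟩
    obtain ⟨w, hw⟩ := SimpleGraph.exists_walk_of_edist_ne_top
      (ne_top_of_le_ne_top (ENat.natCast_ne_top _) h)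
    rw [← hw] at h
    have hlen : w.length ≤ r + 1 := by exact_mod_cast h
    -- split off the last edge of a shortest walk
    rcases Nat.eq_zero_or_pos w.length with h0 | h0
    · obtain rfl := SimpleGraph.Walk.eq_of_length_eq_zero h0
      obtain ⟨t, ht⟩ := hφ e e (by simp)
      exact ⟨(t, none), by simpa [ψ] using ht⟩
    · obtain ⟨t, ht⟩ := hφ e w.penultimate (by
        refine (w.dropLast.edist_le).trans ?_
        have : w.dropLast.length ≤ r := by
          rw [SimpleGraph.Walk.length_dropLast]
          omega
        exact_mod_cast this)
      have hadj : G.lineGraph.Adj w.penultimate f :=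
        w.adj_penultimate (SimpleGraph.Walk.not_nil_iff_lt_length.2 h0)
      obtain ⟨t', ht'⟩ := hψ _ _ hadj
      exact ⟨(t, t'), by simpa [ht] using ht'⟩

end Graph

section Percolation

variable {V Ω : Type*} [Countable V] [MeasurableSpace Ω] {P : Measure Ω} [IsProbabilityMeasure P]
  {clock : V → Ω → Set Atom} {G : SimpleGraph V} [G.LocallyFinite] {α : ℝ}
  {ord : ∀ v, Fin (G.degree v) ≃ G.neighborSet v} {N : ℝ≥0 → Ω → G.edgeSet → ℕ} {Δ : ℕ}

/-- The edges `c 0, …, c n` form a chain that starts near `e`, has bounded steps in the line graph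
and is pairwise separated. The distance `4` makes the closed neighbourhoods of endpoints of
different edges of the chain disjoint; the values `c m` for `m > n` are irrelevant. -/
def IsEdgeChain (G : SimpleGraph V) (e : G.edgeSet) (n : ℕ) (c : ℕ → G.edgeSet) : Prop :=
  G.lineGraph.edist e (c 0) ≤ 8 ∧ (∀ m < n, G.lineGraph.edist (c m) (c (m + 1)) ≤ 8) ∧
    ∀ l m, l < m → m ≤ n → 4 ≤ G.lineGraph.edist (c l) (c m)

/-- The chain encoded by a word in an alphabet `T` that enumerates the balls. Only the entries up
to `n` are meaningful, as the index of the letter is reduced modulo `n + 1`. -/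
def decodeChain {E T : Type*} (φ : E → T → E) (e : E) {n : ℕ} (w : Fin (n + 1) → T) : ℕ → E
  | 0 => φ e (w 0)
  | m + 1 => φ (decodeChain φ e w m) (w (Fin.ofNat (n + 1) (m + 1)))

omit [Countable V] [G.LocallyFinite] in
lemma IsEdgeChain.exists_decode {e : G.edgeSet} {n : ℕ} {c : ℕ → G.edgeSet}
    (hc : IsEdgeChain G e n c) {T : Type*} {φ : G.edgeSet → T → G.edgeSet}
    (hφ : ∀ e f, G.lineGraph.edist e f ≤ 8 → ∃ t, φ e t = f) :
    ∃ w : Fin (n + 1) → T, ∀ m ≤ n, decodeChain φ e w m = c m := by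
  have hex : ∀ m : Fin (n + 1), ∃ t, φ (m.1.casesOn e c) t = c m := by
    rintro ⟨_ | m, hm⟩
    · exact hφ _ _ hc.1
    · exact hφ _ _ (hc.2.1 m (by omega))
  choose w hw using hex
  refine ⟨w, fun m => ?_⟩
  induction m with
  | zero => exact fun _ => hw 0
  | succ m ih =>
    intro hm
    rw [decodeChain, ih (by omega)]
    have h1 := hw ⟨m + 1, by omega⟩
    have h2 : Fin.ofNat (n + 1) (m + 1) = ⟨m + 1, by omega⟩ :=
      Fin.ext (Nat.mod_eq_of_lt (by omega))
    rw [h2]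
    exact h1

/-- Long chains of edges of low rate are exponentially unlikely. -/
lemma IsUrnNetwork.measure_chain_le (hN : IsUrnNetwork G P α ord clock N) (hα : 0 ≤ α)
    (hΔ : ∀ v, G.degree v ≤ Δ) (k₀ : ℕ) {T : Type*} [Fintype T] {φ : G.edgeSet → T → G.edgeSet}
    (hφ : ∀ e f, G.lineGraph.edist e f ≤ 8 → ∃ t, φ e t = f) (e : G.edgeSet) (n : ℕ) :
    P {ω | ∃ c, IsEdgeChain G e n c ∧ ∀ m ≤ n, lowerRate N ω (c m) < (2 ^ (k₀ + 1))⁻¹} ≤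
      (Fintype.card T * lowRateBound α Δ k₀) ^ (n + 1) := by
  classical
  choose x i hxi using exists_slot (G := G) ord
  let B : (Fin (n + 1) → T) → Set Ω := fun w =>
    {ω | (∀ l m, l < m → m ≤ n →
        4 ≤ G.lineGraph.edist (decodeChain φ e w l) (decodeChain φ e w m)) ∧
      ∀ m ≤ n, lowerRate N ω (decodeChain φ e w m) < (2 ^ (k₀ + 1))⁻¹}
  have hB : ∀ w, P (B w) ≤ lowRateBound α Δ k₀ ^ (n + 1) := by
    intro w
    by_cases hsep : ∀ l m, l < m → m ≤ n →
        4 ≤ G.lineGraph.edist (decodeChain φ e w l) (decodeChain φ e w m)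
    · have hmem : ∀ f, x f ∈ f.1 := fun f => by
        have h : x f ∈ (edgeTo G (x f) (ord (x f) (i f))).1 := Sym2.mem_mk_left _ _
        rwa [hxi] at h
      have h1 := hN.measure_lowerRate_lt_le hα hΔ k₀ (x := fun m : ℕ => x (decodeChain φ e w m))
        (fun m => i (decodeChain φ e w m)) (A := Set.univ) (W := ∅) MeasurableSet.univ
        (Finset.range (n + 1)) (by simp) ?_
      · rw [Finset.card_range, measure_univ, mul_one] at h1
        refine le_trans (measure_mono ?_) h1
        rintro ω ⟨-, hω⟩
        refine ⟨Set.mem_univ _, fun m hm => ?_⟩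
        rw [hxi]
        exact hω m (Nat.lt_succ_iff.1 (Finset.mem_range.1 hm))
      · intro l hl m hm hne
        have hl' := Nat.lt_succ_iff.1 (Finset.mem_range.1 (Finset.mem_coe.1 hl))
        have hm' := Nat.lt_succ_iff.1 (Finset.mem_range.1 (Finset.mem_coe.1 hm))
        rcases lt_or_gt_of_ne hne with hlt | hlt
        · exact disjoint_closedNbhd (hmem _) (hmem _) (hsep l m hlt hm')
        · exact (disjoint_closedNbhd (hmem _) (hmem _) (hsep m l hlt hl')).symm
    · have : B w = ∅ := Set.eq_empty_of_forall_notMem fun ω hω => hsep hω.1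
      rw [this, measure_empty]
      exact zero_le
  have hcover : {ω | ∃ c, IsEdgeChain G e n c ∧ ∀ m ≤ n, lowerRate N ω (c m) < (2 ^ (k₀ + 1))⁻¹} ⊆
      ⋃ w ∈ (Finset.univ : Finset (Fin (n + 1) → T)), B w := by
    rintro ω ⟨c, hc, hlow⟩
    obtain ⟨w, hw⟩ := hc.exists_decode hφ
    refine Set.mem_biUnion (x := w) (Finset.mem_coe.2 (Finset.mem_univ w)) ⟨fun l m hlm hm => ?_,
      fun m hm => ?_⟩
    · rw [hw l (hlm.le.trans hm), hw m hm]
      exact hc.2.2 l m hlm hm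
    · rw [hw m hm]
      exact hlow m hm
  refine (measure_mono hcover).trans ((measure_biUnion_finset_le _ _).trans
    ((Finset.sum_le_card_nsmul _ _ _ fun w _ => hB w).trans_eq ?_))
  rw [nsmul_eq_mul, Finset.card_univ, Fintype.card_fun, Fintype.card_fin, mul_pow]
  push_cast
  rfl

omit [Countable V] in
lemma IsEquilibrium.le_two {μ : G.edgeSet → ℝ≥0} (hμ : IsEquilibrium G α μ) (hpos : ∀ e, 0 < μ e)
    (e : G.edgeSet) : μ e ≤ 2 := by
  have hpol : ∀ v, v ∈ e.1 → pol G α (fun e => (μ e : ℝ)) v e ≤ 1 := by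
    intro v hv
    obtain ⟨e, he⟩ := e
    obtain ⟨y, rfl⟩ := Sym2.mem_iff_exists.1 (show v ∈ e from hv)
    refine div_le_one_of_le₀ ?_ (Finset.sum_nonneg fun z _ => by positivity)
    exact Finset.single_le_sum (f := fun z : G.neighborSet v => (μ (edgeTo G v z) : ℝ) ^ α)
      (fun z _ => by positivity) (Finset.mem_univ (⟨y, he⟩ : G.neighborSet v))
  obtain ⟨e, he⟩ := e
  induction e using Sym2.ind with
  | _ x y =>
    have h1 := hμ x y he (hpos _)
    have h2 := hpol x (Sym2.mem_mk_left _ _)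
    have h3 := hpol y (Sym2.mem_mk_right _ _)
    have : (μ ⟨s(x, y), he⟩ : ℝ) ≤ 2 := by linarith
    exact_mod_cast this

omit [Countable V] [MeasurableSpace Ω] in
/-- An infinite component of unstable edges contains arbitrarily long chains of edges of low
rate. -/
lemma exists_chain_of_infinite (hΔ : ∀ v, G.degree v ≤ Δ)
    (ord : ∀ v, Fin (G.degree v) ≃ G.neighborSet v) {μ : G.edgeSet → ℝ≥0} {δ : ℝ≥0} {κ : ℝ≥0∞}
    {ω : Ω}
    (hlow : ∀ e, ¬ IsStable N μ δ ω e → ∃ f ∈ adjacentEdges e, lowerRate N ω f < κ)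
    (C : (unstableGraph N μ δ ω).ConnectedComponent) (hC : C.supp.Infinite) :
    ∃ e : G.edgeSet, ∀ n, ∃ c, IsEdgeChain G e n c ∧ ∀ m ≤ n, lowerRate N ω (c m) < κ := by
  obtain ⟨a, ha⟩ := hC.nonempty
  refine ⟨a.1, fun n => ?_⟩
  obtain ⟨T, hT, φ, hφ⟩ := exists_ball_enumeration hΔ ord (6 * n)
  obtain ⟨b, hbC, hb⟩ : ∃ b ∈ C.supp, ((6 * n : ℕ) : ℕ∞) < G.lineGraph.edist a.1 b.1 := by
    by_contra hno
    push Not at hno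
    refine hC (((Set.finite_range (φ a.1)).preimage Subtype.val_injective.injOn).subset
      fun b hb => ?_)
    exact hφ _ _ (hno b hb)
  have hreach : (unstableGraph N μ δ ω).Reachable a b :=
    SimpleGraph.ConnectedComponent.exact (ha.trans hbC.symm)
  obtain ⟨γ⟩ := hreach
  let F : unstableGraph N μ δ ω →g G.lineGraph := (SimpleGraph.Embedding.induce _).toHom
  obtain ⟨c, hc0, hcs, hcd, hcsep⟩ := exists_separated_chain (r := 6) (by norm_num) n
    (γ.map F) hb
  have hun : ∀ m ≤ n, ¬ IsStable N μ δ ω (c m) := by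
    intro m hm
    have h1 := hcs m hm
    rw [SimpleGraph.Walk.support_map, List.mem_map] at h1
    obtain ⟨y, -, hy⟩ := h1
    rw [← hy]
    exact y.2
  have hf : ∀ m, ∃ f, m ≤ n → G.lineGraph.edist (c m) f ≤ 1 ∧ lowerRate N ω f < κ := by
    intro m
    by_cases hm : m ≤ n
    · obtain ⟨f, ⟨v, hvf, hve⟩, hlt⟩ := hlow _ (hun m hm)
      exact ⟨f, fun _ => ⟨edist_lineGraph_le_one hve hvf, hlt⟩⟩
    · exact ⟨c m, fun h => absurd h hm⟩
  choose f hf using hf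
  have hfc : ∀ m ≤ n, G.lineGraph.edist (f m) (c m) ≤ 1 := fun m hm => by
    rw [SimpleGraph.edist_comm]
    exact (hf m hm).1
  refine ⟨f, ⟨?_, fun m hm => ?_, fun l m hlm hm => ?_⟩, fun m hm => (hf m hm).2⟩
  · have h1 : c 0 = a.1 := hc0
    rw [← h1]
    exact ((hf 0 (Nat.zero_le _)).1).trans (by norm_num)
  · have h1 : G.lineGraph.edist (f m) (f (m + 1)) ≤ 1 + (6 + 1) :=
      (G.lineGraph.edist_triangle (v := c m)).trans (add_le_add (hfc m hm.le)
        ((G.lineGraph.edist_triangle (v := c (m + 1))).trans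
          (add_le_add (hcd m hm) (hf (m + 1) hm).1)))
    exact h1.trans (by decide)
  · by_contra hlt
    have h2 : G.lineGraph.edist (f l) (f m) ≤ 3 := Order.le_of_lt_add_one (not_le.1 hlt)
    have h1 : G.lineGraph.edist (c l) (c m) ≤ 1 + (3 + 1) :=
      (G.lineGraph.edist_triangle (v := f l)).trans (add_le_add (hf l (hlm.le.trans hm)).1
        ((G.lineGraph.edist_triangle (v := f m)).trans (add_le_add h2 (hfc m hm))))
    exact absurd ((hcsep l m hlm hm).trans h1) (by decide)

lemma IsUrnNetwork.exists_finite_components (hN : IsUrnNetwork G P α ord clock N) (hα₀ : 0 ≤ α)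
    (hα₁ : α < 1) (hΔ : ∀ v, G.degree v ≤ Δ) {μ : G.edgeSet → ℝ≥0} (hμ : IsEquilibrium G α μ)
    (hpos : ∀ e, 0 < μ e) :
    ∃ δ₀ : ℝ≥0, 0 < δ₀ ∧ ∀ᵐ ω ∂P,
      ∀ C : (unstableGraph N μ δ₀ ω).ConnectedComponent, C.supp.Finite := by
  obtain ⟨T, hT, φ, hφ⟩ := exists_ball_enumeration hΔ ord 8
  have hφ' : ∀ e f, G.lineGraph.edist e f ≤ 8 → ∃ t, φ e t = f := hφ
  obtain ⟨k₀, hk⟩ := exists_lowRateBound_le α hα₁ Δ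
    (ε := (2 * (Fintype.card T + 1 : ℕ) : ℝ≥0∞)⁻¹) (ENNReal.inv_pos.2
      (ENNReal.mul_ne_top (by norm_num) (ENNReal.natCast_ne_top _)))
  have hsmall : (Fintype.card T : ℝ≥0∞) * lowRateBound α (Δ + 1) k₀ ≤ 2⁻¹ := by
    calc (Fintype.card T : ℝ≥0∞) * lowRateBound α (Δ + 1) k₀
        ≤ (Fintype.card T + 1 : ℕ) * (2 * (Fintype.card T + 1 : ℕ) : ℝ≥0∞)⁻¹ := by
          gcongr
          exact Nat.le_succ _
      _ = 2⁻¹ := by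
          rw [ENNReal.mul_inv (Or.inl (by norm_num)) (Or.inl (by norm_num)), mul_left_comm,
            ENNReal.mul_inv_cancel (by exact_mod_cast Nat.succ_ne_zero (Fintype.card T))
              (ENNReal.natCast_ne_top _), mul_one]
  have hnochain : ∀ᵐ ω ∂P, ∀ e : G.edgeSet, ¬ ∀ n, ∃ c, IsEdgeChain G e n c ∧
      ∀ m ≤ n, lowerRate N ω (c m) < (2 ^ (k₀ + 1))⁻¹ := by
    refine ae_all_iff.2 fun e => ?_
    rw [ae_iff]
    refine le_antisymm (ge_of_tendsto' (x := atTop) (f := fun n : ℕ => (2⁻¹ : ℝ≥0∞) ^ (n + 1))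
      ?_ fun n => ?_) zero_le
    · exact (ENNReal.tendsto_pow_atTop_nhds_zero_of_lt_one
        (ENNReal.inv_lt_one.2 ENNReal.one_lt_two)).comp (tendsto_add_atTop_nat 1)
    · refine le_trans (measure_mono fun ω hω => ?_)
        ((hN.measure_chain_le hα₀ (fun v => (hΔ v).trans (Nat.le_succ Δ)) k₀ hφ' e n).trans
          (pow_le_pow_left' hsmall _))
      exact not_not.1 hω n
  refine ⟨(2 ^ (k₀ + 2))⁻¹, by positivity, ?_⟩
  filter_upwards [hnochain] with ω hω C
  have hlow : ∀ e, ¬ IsStable N μ (2 ^ (k₀ + 2))⁻¹ ω e →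
      ∃ f ∈ adjacentEdges e, lowerRate N ω f < (2 ^ (k₀ + 1))⁻¹ := by
    intro e he
    rw [IsStable] at he
    push Not at he
    obtain ⟨f, hf, hlt⟩ := he
    refine ⟨f, hf, ?_⟩
    rw [ENNReal.div_lt_iff (Or.inl (by exact_mod_cast (hpos f).ne')) (Or.inl (by simp))] at hlt
    -- equilibrium weights are at most `2`
    refine hlt.trans_le ?_
    have h1 : ((2 ^ (k₀ + 2))⁻¹ : ℝ≥0) * μ f ≤ (2 ^ (k₀ + 1))⁻¹ := by
      calc ((2 ^ (k₀ + 2))⁻¹ : ℝ≥0) * μ f ≤ (2 ^ (k₀ + 2))⁻¹ * 2 := by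
            gcongr
            exact hμ.le_two hpos f
        _ = (2 ^ (k₀ + 1))⁻¹ := by
            rw [show k₀ + 2 = k₀ + 1 + 1 by ring, pow_succ _ (k₀ + 1)]
            field_simp
    have hcoe : (((2 ^ (k₀ + 1))⁻¹ : ℝ≥0) : ℝ≥0∞) = (2 ^ (k₀ + 1))⁻¹ := by
      rw [ENNReal.coe_inv (by positivity), ENNReal.coe_pow, ENNReal.coe_ofNat]
    rw [← hcoe]
    exact_mod_cast h1
  by_contra hC
  obtain ⟨e, he⟩ := exists_chain_of_infinite hΔ ord hlow C hC
  exact hω e he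

end Percolation

end PolyaNetwork

theorem lemma3p4 {V : Type*} [Countable V] (G : SimpleGraph V) [G.LocallyFinite]
    (Δ : ℕ) (hΔ : ∀ v, G.degree v ≤ Δ)
    (α : ℝ) (hα₀ : 0 ≤ α) (hα₁ : α < 1)
    (ord : ∀ v, Fin (G.degree v) ≃ G.neighborSet v)
    {Ω : Type*} [MeasurableSpace Ω] (P : Measure Ω) [IsProbabilityMeasure P]
    (clock : V → Ω → Set PolyaNetwork.Atom) (N : ℝ≥0 → Ω → G.edgeSet → ℕ)
    (hN : PolyaNetwork.IsUrnNetwork G P α ord clock N) :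
    -- rate lower bound: finite components of unstable edges
    (∀ μ : G.edgeSet → ℝ≥0, PolyaNetwork.IsEquilibrium G α μ → (∀ e, 0 < μ e) →
      ∃ δ₀ : ℝ≥0, 0 < δ₀ ∧ ∀ᵐ ω ∂P,
        ∀ C : (PolyaNetwork.unstableGraph N μ δ₀ ω).ConnectedComponent, C.supp.Finite) ∧
    -- compact containment: uniform conditional lower bound on the rates
    (∀ ε : ℝ, 0 < ε → ∃ δ : ℝ≥0, 0 < δ ∧ ∀ᵐ ω ∂P, ∀ e : G.edgeSet,
      1 - ε ≤
        (P⟦{ω' | (δ : ℝ≥0∞) ≤ PolyaNetwork.lowerRate N ω' e} | PolyaNetwork.farSigma clock e⟧) ω) ∧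
    (∀ e : G.edgeSet, ∀ᵐ ω ∂P,
      (P⟦{ω' | 0 < PolyaNetwork.lowerRate N ω' e} | PolyaNetwork.farSigma clock e⟧) ω = 1) :=
  ⟨fun _ hμ hpos => hN.exists_finite_components hα₀ hα₁ hΔ hμ hpos,
    fun _ hε => hN.exists_condProb_ge hα₀ hα₁ hΔ hε,
    fun e => hN.condProb_pos_eq_one hα₀ hα₁ hΔ e⟩
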